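/- Let $\alpha_\pm>0$, $\beta_\pm\in(0,1)$, $\lambda_+>1$, $\lambda_->0$. The law $\mathrm{TS}_+(\alpha,\beta,\lambda)$ is the probability law on $[0,\infty)$ with characteristic function $u\mapsto\exp\left(\int_0^\infty (e^{iux}-1)\,\alpha e^{-\lambda x}x^{-1-\beta}\,dx\right)$, and $\mathrm{TS}(\alpha_+,\beta_+,\lambda_+,\alpha_-,\beta_-,\lambda_-)$ is the law of $Y-Z$ with $Y\sim \mathrm{TS}_+(\alpha_+,\beta_+,\lambda_+)$, $Z\sim \mathrm{TS}_+(\alpha_-,\beta_-,\lambda_-)$ independent. Let $(X_t)_{t\ge 0}$ be a TS process on a probability space $(\Omega,\mathcal F,\mathbb P)$, i.e. $X_0=0$ a.s., the increments are independent, and $X_t-X_s\sim \mathrm{TS}(\alpha_+(t-s),\beta_+,\lambda_+,\alpha_-(t-s),\beta_-,\lambda_-)$ for $t>s\geq 0$; let $(\mathcal F_t)$ be its natural filtration. Put $$a_\pm=-\alpha_\pm\Gamma(-\beta_\pm),\quad \underline{\lambda}=\lambda_++\lambda_-,\quad \gamma=a_+\lambda_+^{\beta_+}+a_-\lambda_-^{\beta_-},$$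 $$\zeta=a_+\big((\lambda_+-1)^{\beta_+}-\lambda_+^{\beta_+}\big)+a_-\big((\lambda_-+1)^{\beta_-}-\lambda_-^{\beta_-}\big).$$ Let $S_0,K,T>0$, $r,q\in\mathbb R$, $S_t=S_0e^{(r-q+\zeta)t+X_t}$ and $k=\ln(S_0/K)+(r-q+\zeta)T$. The prices at time $0$ of the cash-or-nothing (CN) and asset-or-nothing (AN) calls with strike $K$ and maturity $T$ are $C_{\mathrm{CN}}=\mathbb E[e^{-rT}\mathbf 1_{\{S_T>K\}}\mid\mathcal F_0]$ and $C_{\mathrm{AN}}=\mathbb E[e^{-rT}S_T\mathbf 1_{\{S_T>K\}}\mid\mathcal F_0]$. For $b>0$ and $s\in\mathbb C^4$, set $$G_b(s)=\frac{\Gamma\left(s_3-\frac{s_1+s_2}2\right)\Gamma\left(1+\frac{s_1+s_2}2+s_3\right)\Gamma\left(\frac{s_1-s_2}2-s_3\right)\Gamma\left(-\frac{s_1}{\beta_+}\right)\Gamma\left(-\frac{s_2}{\beta_-}\right)\Gamma(s_4)}{\Gamma(1+s_1)\Gamma(-s_1)\Gamma(-s_2)\left(\frac{s_1+s_2}{2}+s_3+s_4\right)}\;\underline{\lambda}^{\frac{s_1+s_2}2-s_3}\,b^{-s_4}(a_+T)^{\frac{s_1}{\beta_+}}(a_-T)^{\frac{s_2}{\beta_-}}(-k)^{-\frac{s_1+s_2}2-s_3-s_4}.$$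 Suppose that $k<0$, and let $c\in\mathbb R^4$ be any vector such that, at $s=c$, the arguments of the six gamma functions in the numerator of $G_b$ and the number $\frac{s_1+s_2}2+s_3+s_4$ are all positive. Then both payoffs are integrable, $G_{\lambda_+}$ and $G_{\lambda_+-1}$ are absolutely integrable over $c+i\mathbb R^4$, and, almost surely, $$C_{\mathrm{CN}}=\frac{e^{(\gamma-r)T}}{\beta_+\beta_-}\int_{c+i\mathbb R^4}G_{\lambda_+}(s)\,\frac{ds}{(2\pi i)^4},\qquad C_{\mathrm{AN}}=\frac{Ke^{k+(\gamma-r)T}}{\beta_+\beta_-}\int_{c+i\mathbb R^4}G_{\lambda_+-1}(s)\,\frac{ds}{(2\pi i)^4}.$$ -/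

import Mathlib

open MeasureTheory ProbabilityTheory
open scoped NNReal Matrix

noncomputable section

/-! ### Tempered stable distributions and processes -/

/-- Density of the Lévy measure of the one-sided tempered stable law. -/
def levyDensityTSPlus (α β lam : ℝ) (x : ℝ) : ℝ :=
  (Set.Ioi (0 : ℝ)).indicator (fun x => α * Real.exp (-lam * x) / x ^ (1 + β)) x

/-- `μ` is the law `TS₊(α, β, lam)`: a probability measure supported by `[0, ∞)` with
characteristic function `u ↦ exp (∫ (e^{iux} - 1) ν(x) dx)`. -/
structure IsTSPlus (μ : Measure ℝ) (α β lam : ℝ) : Prop where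
  isProb : IsProbabilityMeasure μ
  support : μ (Set.Iio 0) = 0
  charFun_eq : ∀ u : ℝ, charFun μ u =
    Complex.exp (∫ x : ℝ,
      (Complex.exp (Complex.I * u * x) - 1) * (levyDensityTSPlus α β lam x : ℂ))

/-- `μ` is the double-sided law `TS(αp, βp, lamp, αm, βm, lamm)`: the convolution of a `TS₊` law
and of the reflection of a `TS₊` law. -/
def IsTS (μ : Measure ℝ) (αp βp lamp αm βm lamm : ℝ) : Prop :=
  ∃ μp μm : Measure ℝ, IsTSPlus μp αp βp lamp ∧ IsTSPlus μm αm βm lamm ∧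
    μ = μp.conv (μm.map (fun x => -x))

/-- `X` is a tempered stable process: it starts from `0` and has independent and stationary
increments, the increment over `[s, t]` having the law
`TS(αp (t - s), βp, lamp, αm (t - s), βm, lamm)`. -/
structure IsTSProcess {Ω : Type*} [MeasurableSpace Ω] (P : Measure Ω) (X : ℝ≥0 → Ω → ℝ)
    (αp βp lamp αm βm lamm : ℝ) : Prop where
  zero : ∀ᵐ ω ∂P, X 0 ω = 0
  indep : HasIndepIncrements X P
  law : ∀ s t : ℝ≥0, s < t →
    IsTS (P.map (fun ω => X t ω - X s ω))
      (αp * ((t : ℝ) - s)) βp lamp (αm * ((t : ℝ) - s)) βm lamm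

/-! ### The market model -/

/-- The constant `a = -α Γ(-β)`. -/
def tsA (α β : ℝ) : ℝ := -α * Real.Gamma (-β)

/-- The constant `γ`. -/
def tsGamma (αp βp lamp αm βm lamm : ℝ) : ℝ :=
  tsA αp βp * lamp ^ βp + tsA αm βm * lamm ^ βm

/-- The martingale adjustment `ζ`. -/
def tsZeta (αp βp lamp αm βm lamm : ℝ) : ℝ :=
  tsA αp βp * ((lamp - 1) ^ βp - lamp ^ βp) + tsA αm βm * ((lamm + 1) ^ βm - lamm ^ βm)

/-- The asset price `S_t = S₀ e^{(r - q + ζ) t + X_t}`. -/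
def assetPrice {Ω : Type*} (X : ℝ≥0 → Ω → ℝ) (S₀ r q ζ : ℝ) (t : ℝ≥0) (ω : Ω) : ℝ :=
  S₀ * Real.exp ((r - q + ζ) * t + X t ω)

/-- The log-forward moneyness `k = ln (S₀ / K) + (r - q + ζ) T`. -/
def moneyness (S₀ K r q ζ T : ℝ) : ℝ := Real.log (S₀ / K) + (r - q + ζ) * T

/-- Cash-or-nothing call payoff. -/
def payoffCN (K : ℝ) (S : ℝ) : ℝ := (Set.Ioi K).indicator (fun _ => 1) S

/-- Asset-or-nothing call payoff. -/
def payoffAN (K : ℝ) (S : ℝ) : ℝ := (Set.Ioi K).indicator (fun S => S) S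

/-- The price at time `t` of the claim delivering `payoff S_T` at time `T`: the conditional
expectation of the discounted payoff, given the natural filtration of `X` at time `t`. -/
def claimPrice {Ω : Type*} [MeasurableSpace Ω] (P : Measure Ω) (X : ℝ≥0 → Ω → ℝ)
    (hXm : ∀ t, StronglyMeasurable (X t)) (S₀ r q ζ : ℝ) (payoff : ℝ → ℝ) (T t : ℝ≥0) : Ω → ℝ :=
  P[fun ω => Real.exp (-r * ((T : ℝ) - t)) * payoff (assetPrice X S₀ r q ζ T ω) |
    Filtration.natural X hXm t]

/-! ### Mellin–Barnes integrals -/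

/-- The point `c + i y` of `c + i ℝⁿ`. -/
def contourPoint {n : ℕ} (c y : Fin n → ℝ) : Fin n → ℂ := fun j => c j + Complex.I * y j

/-- Absolute convergence of the integral of `F` over `c + i ℝⁿ`. -/
def MBIntegrable {n : ℕ} (c : Fin n → ℝ) (F : (Fin n → ℂ) → ℂ) : Prop :=
  Integrable (fun y : Fin n → ℝ => F (contourPoint c y))

/-- `∫_{c + i ℝⁿ} F(s) ds / (2 π i)ⁿ`, where `ds = iⁿ dy` on `c + i ℝⁿ`. -/
def mbIntegral {n : ℕ} (c : Fin n → ℝ) (F : (Fin n → ℂ) → ℂ) : ℂ :=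
  (∫ y : Fin n → ℝ, F (contourPoint c y) * Complex.I ^ n) / (2 * Real.pi * Complex.I) ^ n

/-- Quotient of products of gamma functions. -/
def gammaQuot {m p : ℕ} (v : Fin m → ℂ) (w : Fin p → ℂ) : ℂ :=
  (∏ i, Complex.Gamma (v i)) / ∏ i, Complex.Gamma (w i)

/-- The matrix `U`. -/
def matU (βp βm : ℝ) : Matrix (Fin 6) (Fin 4) ℝ :=
  !![-1/2, -1/2, 1, 0;
     1/2, 1/2, 1, 0;
     1/2, -1/2, -1, 0;
     -βp⁻¹, 0, 0, 0;
     0, -βm⁻¹, 0, 0;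
     0, 0, 0, 1]

/-- The vector `u`. -/
def vecU : Fin 6 → ℝ := ![0, 1, 0, 0, 0, 0]

/-- The matrix `D_TS`. -/
def matD : Matrix (Fin 3) (Fin 2) ℝ :=
  !![1, 0;
     -1, 0;
     0, -1]

/-- The vector `d_TS`. -/
def vecD : Fin 3 → ℝ := ![1, 0, 0]

/-- The admissible real parts of the contour. -/
def admissible (βp βm : ℝ) : Set (Fin 4 → ℝ) :=
  {x | (∀ i, 0 < (matU βp βm *ᵥ x + vecU) i) ∧ 0 < x ⬝ᵥ ![1/2, 1/2, 1, 1]}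

/-- The common integrand of the two representations: `b` is the base of the power `b^{-s₄}`,
`lamSum = λ₊ + λ₋`, `Ap = a₊ T`, `Am = a₋ T`, and `k` is the moneyness. -/
def callIntegrand (βp βm lamSum b Ap Am k : ℝ) (s : Fin 4 → ℂ) : ℂ :=
  gammaQuot
      ((matU βp βm).map Complex.ofReal *ᵥ s + fun i => (vecU i : ℂ))
      (matD.map Complex.ofReal *ᵥ ![s 0, s 1] + fun i => (vecD i : ℂ))
    / ((s 0 + s 1) / 2 + s 2 + s 3)
    * (lamSum : ℂ) ^ ((s 0 + s 1) / 2 - s 2)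
    * (b : ℂ) ^ (-s 3)
    * (Ap : ℂ) ^ (s 0 / βp)
    * (Am : ℂ) ^ (s 1 / βm)
    * ((-k : ℝ) : ℂ) ^ (-((s 0 + s 1) / 2) - s 2 - s 3)

end

/-!
Tilting the law `TS₊(α, β, λ)` by `e^{λ x}` gives a multiple of the totally skewed `β`-stable law,
whose moments of negative order, hence whose Mellin transform, are explicit quotients of gamma
functions. Write the expectation of `e^{p X_T} 1_{X_T > κ}`, `κ = -k`, as a double integral over
`x > κ` and the negative part `z > 0` of `X_T`: the positive part `x + z` has a density which
Mellin inversion expresses as a line integral of powers of `x + z`. The binomial Mellin–Barnes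
formula for `(x + z)^{-s}` and the Cahen–Mellin formula for the exponentials of `z` and of `x`
then separate `x` from `z`, at the price of one contour integral each. By Fubini the `x`- and
`z`-integrals can be taken first: the former is elementary, the latter is again a moment of a
tilted law, and what remains is the fourfold Mellin–Barnes integral.
-/

/-! ### The gamma function on vertical lines -/

section GammaFunction

open Complex Set Filter Topology
open scoped Real

/-- The point `c + i y` of the vertical line `re s = c`, parametrised by its imaginary part. -/
def linePoint (c y : ℝ) : ℂ := c + y * I

@[simp] lemma linePoint_re (c y : ℝ) : (linePoint c y).re = c := by simp [linePoint]

@[simp] lemma linePoint_im (c y : ℝ) : (linePoint c y).im = y := by simp [linePoint]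

lemma neg_linePoint (c y : ℝ) : -linePoint c y = linePoint (-c) (-y) := by
  simp [Complex.ext_iff]

lemma one_add_linePoint (c y : ℝ) : 1 + linePoint c y = linePoint (1 + c) y := by
  simp [Complex.ext_iff]

lemma linePoint_sub (c c' y y' : ℝ) :
    linePoint c y - linePoint c' y' = linePoint (c - c') (y - y') := by
  simp [Complex.ext_iff]

lemma linePoint_div (c y r : ℝ) : linePoint c y / r = linePoint (c / r) (y / r) := by
  simp [Complex.ext_iff]

@[fun_prop]
lemma continuous_linePoint (c : ℝ) : Continuous (linePoint c) := by
  unfold linePoint; fun_prop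

lemma norm_cpow_linePoint {t : ℝ} (ht : 0 < t) (c y : ℝ) : ‖(t : ℂ) ^ linePoint c y‖ = t ^ c := by
  rw [norm_cpow_eq_rpow_re_of_pos ht, linePoint_re]

lemma eqOn_re_pos_of_eqOn_ofReal_pos {f g : ℂ → ℂ} (hf : DifferentiableOn ℂ f {z | 0 < z.re})
    (hg : DifferentiableOn ℂ g {z | 0 < z.re}) (h : ∀ x : ℝ, 0 < x → f x = g x) :
    EqOn f g {z | 0 < z.re} := by
  have hopen : IsOpen {z : ℂ | 0 < z.re} := isOpen_lt continuous_const continuous_re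
  have htendsto : Tendsto ((↑) : ℝ → ℂ) (𝓝[≠] 1) (𝓝[≠] 1) := by
    exact_mod_cast (ofRealCLM.hasDerivAt (x := 1)).tendsto_nhdsNE (by simp)
  refine (hf.analyticOnNhd hopen).eqOn_of_preconnected_of_frequently_eq (hg.analyticOnNhd hopen)
    (convex_halfSpace_re_gt 0).isPreconnected (z₀ := 1) (by simp) (htendsto.frequently ?_)
  exact (((lt_mem_nhds one_pos).filter_mono nhdsWithin_le_nhds).mono h).frequently

lemma integrableOn_rpow_mul_exp_neg_mul {s b : ℝ} (hs : -1 < s) (hb : 0 < b) :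
    IntegrableOn (fun t : ℝ => t ^ s * Real.exp (-(b * t))) (Ioi 0) := by
  simpa only [Real.rpow_one, neg_mul] using integrableOn_rpow_mul_exp_neg_mul_rpow hs one_pos hb

lemma norm_cpow_mul_cexp {a r : ℂ} {t : ℝ} (ht : 0 < t) :
    ‖(t : ℂ) ^ a * cexp (-(r * t))‖ = t ^ a.re * Real.exp (-(r.re * t)) := by
  simp [norm_cpow_eq_rpow_re_of_pos ht, norm_exp]

lemma aestronglyMeasurable_cpow_mul_cexp (a r : ℂ) :
    AEStronglyMeasurable (fun t : ℝ => (t : ℂ) ^ a * cexp (-(r * t)))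
      (volume.restrict (Ioi 0)) := by
  fun_prop

lemma integrableOn_cpow_mul_cexp {a r : ℂ} (ha : -1 < a.re) (hr : 0 < r.re) :
    IntegrableOn (fun t : ℝ => (t : ℂ) ^ a * cexp (-(r * t))) (Ioi 0) := by
  refine (integrableOn_rpow_mul_exp_neg_mul ha hr).mono' (aestronglyMeasurable_cpow_mul_cexp a r) ?_
  filter_upwards [ae_restrict_mem measurableSet_Ioi] with t ht
  exact (norm_cpow_mul_cexp ht).le

lemma hasDerivAt_integral_cpow_mul_cexp {a r : ℂ} (ha : 0 < a.re) (hr : 0 < r.re) :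
    HasDerivAt (fun r : ℂ => ∫ t : ℝ in Ioi 0, (t : ℂ) ^ (a - 1) * cexp (-(r * t)))
      (∫ t : ℝ in Ioi 0, -((t : ℂ) ^ a * cexp (-(r * t)))) r := by
  have hr2 : 0 < r.re / 2 := half_pos hr
  refine (hasDerivAt_integral_of_dominated_loc_of_deriv_le
    (F' := fun r t => -((t : ℂ) ^ a * cexp (-(r * t))))
    (bound := fun t : ℝ => t ^ a.re * Real.exp (-(r.re / 2 * t)))
    (Metric.ball_mem_nhds r hr2) ?_ ?_ (aestronglyMeasurable_cpow_mul_cexp _ _).neg ?_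
    (integrableOn_rpow_mul_exp_neg_mul (by linarith) hr2) ?_).2
  · exact Eventually.of_forall fun z => aestronglyMeasurable_cpow_mul_cexp _ _
  · exact integrableOn_cpow_mul_cexp (by simpa using ha) hr
  · filter_upwards [ae_restrict_mem measurableSet_Ioi] with t (ht : 0 < t) z hz
    have hz' : r.re / 2 ≤ z.re := by
      have := abs_le.1 ((abs_re_le_norm (z - r)).trans (mem_ball_iff_norm.1 hz).le)
      linarith [sub_re z r]
    rw [norm_neg, norm_cpow_mul_cexp ht]
    gcongr
  · filter_upwards [ae_restrict_mem measurableSet_Ioi] with t ht z _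
    have ht0 : (t : ℂ) ≠ 0 := ofReal_ne_zero.2 (ne_of_gt ht)
    have hexp : HasDerivAt (fun z : ℂ => cexp (-(z * t))) (cexp (-(z * t)) * -(1 * t)) z :=
      ((hasDerivAt_id z).mul_const (t : ℂ)).neg.cexp
    refine (hexp.const_mul ((t : ℂ) ^ (a - 1))).congr_deriv ?_
    rw [cpow_sub _ _ ht0, cpow_one]
    field_simp

lemma integral_cpow_mul_cexp_Ioi {a r : ℂ} (ha : 0 < a.re) (hr : 0 < r.re) :
    ∫ t : ℝ in Ioi 0, (t : ℂ) ^ (a - 1) * cexp (-(r * t)) = r ^ (-a) * Gamma a := by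
  refine eqOn_re_pos_of_eqOn_ofReal_pos
    (fun z hz => (hasDerivAt_integral_cpow_mul_cexp ha hz).differentiableAt.differentiableWithinAt)
    (fun z hz => ((differentiableAt_id.cpow_const (Or.inl hz)).mul_const
      (Gamma a)).differentiableWithinAt) (fun x hx => ?_) hr
  rw [integral_cpow_mul_exp_neg_mul_Ioi ha hx, one_div, cpow_neg, inv_cpow]
  · rfl
  · rw [arg_ofReal_of_nonneg hx.le]
    exact Real.pi_ne_zero.symm

-- Rotating the ray of Euler's integral by the angle `τ` multiplies the integrand by a factor of
-- modulus `e ^ (τ y)`.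
lemma norm_Gamma_linePoint_mul_exp_le {σ τ : ℝ} (hσ : 0 < σ) (hτ : |τ| < π / 2) (y : ℝ) :
    ‖Gamma (linePoint σ y)‖ * Real.exp (τ * y) ≤ Real.Gamma σ * Real.cos τ ^ (-σ) := by
  obtain ⟨hτ₁, hτ₂⟩ := abs_lt.1 hτ
  have hcos : 0 < Real.cos τ := Real.cos_pos_of_mem_Ioo ⟨hτ₁, hτ₂⟩
  have hre : (cexp (τ * I)).re = Real.cos τ := exp_ofReal_mul_I_re τ
  have hnorm : ‖cexp (τ * I) ^ (-linePoint σ y)‖ = Real.exp (τ * y) := by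
    rw [cpow_def_of_ne_zero (exp_ne_zero _),
      log_exp (by simp; linarith) (by simp; linarith), norm_exp]
    simp
  calc ‖Gamma (linePoint σ y)‖ * Real.exp (τ * y)
      = ‖∫ t : ℝ in Ioi 0, (t : ℂ) ^ (linePoint σ y - 1) * cexp (-(cexp (τ * I) * t))‖ := by
        rw [integral_cpow_mul_cexp_Ioi (by simpa) (hre ▸ hcos), norm_mul, hnorm, mul_comm]
    _ ≤ ∫ t : ℝ in Ioi 0, t ^ (σ - 1) * Real.exp (-(Real.cos τ * t)) := by
        refine norm_integral_le_of_norm_le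
          (integrableOn_rpow_mul_exp_neg_mul (by linarith) hcos) ?_
        filter_upwards [ae_restrict_mem measurableSet_Ioi] with t ht
        rw [norm_cpow_mul_cexp ht, hre, sub_re, linePoint_re, one_re]
    _ = Real.Gamma σ * Real.cos τ ^ (-σ) := by
        rw [Real.integral_rpow_mul_exp_neg_mul_Ioi hσ hcos, one_div, Real.inv_rpow hcos.le,
          Real.rpow_neg hcos.le, mul_comm]

/-- The constant in the bound of `|Γ(σ + i y)|` by a multiple of `e ^ (-θ |y|)`, where
`|θ| < π / 2`. -/
noncomputable def gammaBound (σ θ : ℝ) : ℝ := Real.Gamma σ * Real.cos θ ^ (-σ)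

lemma gammaBound_pos {σ θ : ℝ} (hσ : 0 < σ) (hθ : |θ| < π / 2) : 0 < gammaBound σ θ :=
  mul_pos (Real.Gamma_pos_of_pos hσ)
    (Real.rpow_pos_of_pos (Real.cos_pos_of_mem_Ioo (abs_lt.1 hθ)) _)

lemma norm_Gamma_linePoint_le {σ θ : ℝ} (hσ : 0 < σ) (hθ : |θ| < π / 2) (y : ℝ) :
    ‖Gamma (linePoint σ y)‖ ≤ gammaBound σ θ * Real.exp (-(θ * |y|)) := by
  rw [Real.exp_neg, ← div_eq_mul_inv, le_div_iff₀ (Real.exp_pos _), gammaBound]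
  rcases abs_choice y with hy | hy <;> rw [hy]
  · exact norm_Gamma_linePoint_mul_exp_le hσ hθ y
  · rw [mul_neg, ← neg_mul, ← Real.cos_neg]
    exact norm_Gamma_linePoint_mul_exp_le hσ (by rwa [abs_neg]) y

lemma continuous_Gamma_linePoint {σ : ℝ} (hσ : 0 < σ) :
    Continuous fun y : ℝ => Gamma (linePoint σ y) := by
  refine continuous_iff_continuousAt.2 fun y => ContinuousAt.comp (g := Gamma)
    (differentiableAt_Gamma _ fun m h => ?_).continuousAt (continuous_linePoint σ).continuousAt
  have hre := congrArg re h
  rw [linePoint_re, neg_re, natCast_re] at hre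
  linarith [Nat.cast_nonneg (α := ℝ) m]

lemma integrable_exp_neg_mul_abs {δ : ℝ} (hδ : 0 < δ) :
    Integrable fun y : ℝ => Real.exp (-(δ * |y|)) := by
  rw [← integrableOn_univ, ← Iic_union_Ioi (a := (0 : ℝ))]
  refine IntegrableOn.union ?_ ?_
  · refine (integrableOn_exp_mul_Iic hδ 0).congr_fun (fun y (hy : y ≤ 0) => ?_)
      measurableSet_Iic
    simp [abs_of_nonpos hy]
  · refine (integrableOn_exp_mul_Ioi (neg_lt_zero.2 hδ) 0).congr_fun (fun y (hy : 0 < y) => ?_)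
      measurableSet_Ioi
    simp [abs_of_pos hy]

lemma integrable_Gamma_linePoint {σ : ℝ} (hσ : 0 < σ) :
    Integrable fun y : ℝ => Gamma (linePoint σ y) :=
  ((integrable_exp_neg_mul_abs one_pos).const_mul _).mono'
    (continuous_Gamma_linePoint hσ).aestronglyMeasurable
    (Eventually.of_forall
      (norm_Gamma_linePoint_le hσ (by rw [abs_one]; linarith [Real.pi_gt_three])))

lemma integral_Gamma_mul_cpow_neg {σ x : ℝ} (hσ : 0 < σ) (hx : 0 < x) :
    ∫ y : ℝ, Gamma (linePoint σ y) * (x : ℂ) ^ (-linePoint σ y) = 2 * π * Real.exp (-x) := by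
  set f : ℝ → ℂ := fun x => (Real.exp (-x) : ℝ) with hf
  have hmellin (y : ℝ) : mellin f (σ + y * I) = Gamma (linePoint σ y) := by
    rw [← linePoint, Gamma_eq_integral (by simpa), GammaIntegral_eq_mellin]
  have hconv : MellinConvergent f σ := by
    refine (GammaIntegral_convergent (s := (σ : ℂ)) (by simpa)).congr_fun (fun t _ => ?_)
      measurableSet_Ioi
    simp [hf, mul_comm]
  have hinv := mellinInv_mellin_eq σ f hx hconv
    (by simpa only [VerticalIntegrable, hmellin] using integrable_Gamma_linePoint hσ)
    (by fun_prop)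
  simp only [mellinInv, hmellin, smul_eq_mul, real_smul] at hinv
  rw [show ((Real.exp (-x) : ℝ) : ℂ) = f x from rfl, ← hinv, ← mul_assoc]
  push_cast
  rw [mul_one_div_cancel (by simp [Real.pi_ne_zero]), one_mul]
  simp only [linePoint, mul_comm]

/-! ### Mellin–Barnes integrals of products of gamma functions -/

/-- The integrand of the double integral that evaluates the Mellin–Barnes integral of
`Γ(s) Γ(ρ - s) v ^ (-s)`, `s = σ + i w`: integrating over `t > 0` produces `Γ(ρ - s)`, integrating
over `w` produces `e ^ (-t v)`. -/
noncomputable def barnesKernel (σ v : ℝ) (ρ : ℂ) (t w : ℝ) : ℂ :=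
  (t : ℂ) ^ (ρ - 1 - linePoint σ w) * cexp (-(1 * t)) *
    (Gamma (linePoint σ w) * (v : ℂ) ^ (-linePoint σ w))

lemma integrable_barnesKernel {σ v : ℝ} {ρ : ℂ} (hσ : 0 < σ) (hρ : σ < ρ.re) (hv : 0 < v) :
    Integrable (Function.uncurry (barnesKernel σ v ρ)) ((volume.restrict (Ioi 0)).prod volume) := by
  have hmeas : Measurable (Function.uncurry (barnesKernel σ v ρ)) := by
    have hΓ : Measurable fun p : ℝ × ℝ => Gamma (linePoint σ p.2) :=
      (continuous_Gamma_linePoint hσ).measurable.comp measurable_snd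
    have hline : Measurable (linePoint σ) := (continuous_linePoint σ).measurable
    unfold barnesKernel Function.uncurry
    fun_prop
  have ht : Integrable (fun t : ℝ => t ^ (ρ.re - 1 - σ) * Real.exp (-(1 * t)))
      (volume.restrict (Ioi 0)) :=
    integrableOn_rpow_mul_exp_neg_mul (by linarith) one_pos
  refine (ht.mul_prod ((integrable_Gamma_linePoint hσ).norm.mul_const (v ^ (-σ)))).mono'
    hmeas.aestronglyMeasurable ?_
  filter_upwards [Measure.quasiMeasurePreserving_fst.ae (ae_restrict_mem measurableSet_Ioi)]
    with p hp
  rw [Function.uncurry, barnesKernel, norm_mul, norm_cpow_mul_cexp hp, norm_mul, neg_linePoint,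
    norm_cpow_linePoint hv]
  simp

lemma integral_barnesKernel_right {σ v t : ℝ} {ρ : ℂ} (hσ : 0 < σ) (hv : 0 < v) (ht : 0 < t) :
    ∫ w, barnesKernel σ v ρ t w
      = 2 * π * ((t : ℂ) ^ (ρ - 1) * cexp (-(((1 + v : ℝ) : ℂ) * t))) := by
  have hkernel (w : ℝ) : barnesKernel σ v ρ t w = (t : ℂ) ^ (ρ - 1) * cexp (-(1 * t)) *
      (Gamma (linePoint σ w) * ((t * v : ℝ) : ℂ) ^ (-linePoint σ w)) := by
    rw [barnesKernel, ofReal_mul, mul_cpow_ofReal_nonneg ht.le hv.le, sub_eq_add_neg (ρ - 1),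
      cpow_add _ _ (ofReal_ne_zero.2 ht.ne')]
    ring
  have hexp : cexp (-(((1 + v : ℝ) : ℂ) * t)) = cexp (-(1 * t)) * Real.exp (-(t * v)) := by
    rw [ofReal_exp, ← exp_add]
    push_cast
    ring_nf
  simp_rw [hkernel]
  rw [integral_const_mul, integral_Gamma_mul_cpow_neg hσ (mul_pos ht hv), hexp]
  ring

lemma integral_barnesKernel_left {σ v w : ℝ} {ρ : ℂ} (hρ : σ < ρ.re) :
    ∫ t in Ioi (0 : ℝ), barnesKernel σ v ρ t w =
      Gamma (linePoint σ w) * Gamma (ρ - linePoint σ w) * (v : ℂ) ^ (-linePoint σ w) := by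
  simp_rw [barnesKernel]
  rw [integral_mul_const, sub_right_comm,
    integral_cpow_mul_cexp_Ioi (by simpa using hρ) (by simp), one_cpow]
  ring

lemma integral_Gamma_mul_Gamma_mul_cpow_neg {σ v : ℝ} {ρ : ℂ} (hσ : 0 < σ) (hρ : σ < ρ.re)
    (hv : 0 < v) :
    ∫ w : ℝ, Gamma (linePoint σ w) * Gamma (ρ - linePoint σ w) * (v : ℂ) ^ (-linePoint σ w)
      = 2 * π * (Gamma ρ * ((1 + v : ℝ) : ℂ) ^ (-ρ)) :=
  calc _ = ∫ w, ∫ t in Ioi (0 : ℝ), barnesKernel σ v ρ t w := by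
        simp_rw [integral_barnesKernel_left hρ]
    _ = ∫ t in Ioi (0 : ℝ), ∫ w, barnesKernel σ v ρ t w :=
        (integral_integral_swap (integrable_barnesKernel hσ hρ hv)).symm
    _ = ∫ t in Ioi (0 : ℝ), 2 * π * ((t : ℂ) ^ (ρ - 1) * cexp (-(((1 + v : ℝ) : ℂ) * t))) :=
        setIntegral_congr_fun measurableSet_Ioi fun t ht => integral_barnesKernel_right hσ hv ht
    _ = 2 * π * (Gamma ρ * ((1 + v : ℝ) : ℂ) ^ (-ρ)) := by
        rw [integral_const_mul, integral_cpow_mul_cexp_Ioi (hσ.trans hρ)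
          (by rw [ofReal_re]; linarith), mul_comm (Gamma ρ)]

lemma norm_sin_le_exp_abs_im (z : ℂ) : ‖Complex.sin z‖ ≤ Real.exp |z.im| := by
  have h₁ : ‖cexp (-z * I)‖ ≤ Real.exp |z.im| := by
    rw [norm_exp]; gcongr; simpa using le_abs_self z.im
  have h₂ : ‖cexp (z * I)‖ ≤ Real.exp |z.im| := by
    rw [norm_exp]; gcongr; simpa using neg_le_abs z.im
  rw [Complex.sin, norm_div, norm_mul, norm_I, mul_one, RCLike.norm_ofNat,
    div_le_iff₀ two_pos, mul_two]
  exact (norm_sub_le _ _).trans (add_le_add h₁ h₂)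

lemma norm_inv_Gamma_neg_mul_Gamma_one_add_le (s : ℂ) :
    ‖(Gamma (-s) * Gamma (1 + s))⁻¹‖ ≤ Real.exp (π * |s.im|) := by
  have hreflection : (Gamma (-s) * Gamma (1 + s))⁻¹ = Complex.sin (π * -s) / π := by
    rw [← sub_neg_eq_add, Gamma_mul_Gamma_one_sub, inv_div]
  calc ‖(Gamma (-s) * Gamma (1 + s))⁻¹‖ = ‖Complex.sin (π * -s)‖ / π := by
        rw [hreflection, norm_div, norm_real, Real.norm_of_nonneg Real.pi_pos.le]
    _ ≤ ‖Complex.sin (π * -s)‖ :=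
        div_le_self (norm_nonneg _) (by linarith [Real.pi_gt_three])
    _ ≤ Real.exp (π * |s.im|) := by
        refine (norm_sin_le_exp_abs_im _).trans_eq ?_
        rw [im_ofReal_mul, neg_im, abs_mul, abs_neg, abs_of_pos Real.pi_pos]

lemma continuous_inv_Gamma : Continuous fun s : ℂ => (Gamma s)⁻¹ :=
  differentiable_one_div_Gamma.continuous

lemma exists_pi_lt_div_add_mul {β : ℝ} (hβ : 0 < β) (hβ1 : β < 1) :
    ∃ θ η : ℝ, 0 < θ ∧ |θ| < π / 2 ∧ 0 < η ∧ η < 1 ∧ π < θ / β + (1 - η) * θ := by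
  have hinv : 1 < β⁻¹ := (one_lt_inv₀ hβ).2 hβ1
  obtain ⟨η, hη0, hη⟩ : ∃ η, 0 < η ∧ η < min 1 (β⁻¹ - 1) :=
    exists_between (lt_min one_pos (by linarith))
  obtain ⟨hη1, hηβ⟩ := lt_min_iff.1 hη
  have hsum : 2 < β⁻¹ + (1 - η) := by linarith
  obtain ⟨θ, hθ, hθ2⟩ : ∃ θ, π / (β⁻¹ + (1 - η)) < θ ∧ θ < π / 2 := exists_between (by gcongr)
  have hθ0 : 0 < θ := lt_trans (by positivity) hθ
  rw [div_lt_iff₀ (by linarith)] at hθ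
  exact ⟨θ, η, hθ0, by rwa [abs_of_pos hθ0], hη0, hη1, by rw [div_eq_mul_inv]; linarith⟩

/-- `β` times the Mellin transform `s ↦ ∫ y ^ s ν(dy)` of the one-sided stable law `ν` whose
Laplace transform is `p ↦ exp (-A p ^ β)`. -/
noncomputable def stableMellin (A β : ℝ) (s : ℂ) : ℂ :=
  (A : ℂ) ^ (s / β) * (Gamma (-s / β) / Gamma (-s))

/-- The product of `M(s) / Γ(1 + s)` and the Barnes kernel `Γ(w) Γ(1 + s - w)`, for `s = c + i p.1`
and `w = σ + i p.2`; it couples two of the contour variables. -/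
noncomputable def coupledFactor (M : ℂ → ℂ) (c σ : ℝ) (p : ℝ × ℝ) : ℂ :=
  M (linePoint c p.1) / Gamma (1 + linePoint c p.1) *
    (Gamma (linePoint σ p.2) * Gamma (1 + linePoint c p.1 - linePoint σ p.2))

section StableMellin

variable {A β c σ : ℝ}

lemma continuous_stableMellin_linePoint (hA : 0 < A) (hβ : 0 < β) (hc : c < 0) :
    Continuous fun y => stableMellin A β (linePoint c y) := by
  have hcβ : 0 < -c / β := div_pos (neg_pos.2 hc) hβ
  unfold stableMellin
  simp_rw [neg_linePoint, linePoint_div, div_eq_mul_inv (Gamma _)]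
  refine Continuous.mul (Continuous.const_cpow (by fun_prop) (Or.inl (by exact_mod_cast hA.ne')))
    (Continuous.mul ?_ (continuous_inv_Gamma.comp (by fun_prop)))
  exact (continuous_Gamma_linePoint hcβ).comp (by fun_prop : Continuous fun y : ℝ => -y / β)

-- The reflection formula turns `1 / (Γ(-s) Γ(1 + s))` into a sine, which costs `e ^ (π |y|)`.
lemma norm_stableMellin_div_Gamma_one_add_le (hA : 0 < A) (hβ : 0 < β) (hc : c < 0) {θ : ℝ}
    (hθ : |θ| < π / 2) (y : ℝ) :
    ‖stableMellin A β (linePoint c y) / Gamma (1 + linePoint c y)‖ ≤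
      A ^ (c / β) * gammaBound (-c / β) θ * Real.exp (-((θ / β - π) * |y|)) := by
  have hΓ := norm_Gamma_linePoint_le (div_pos (neg_pos.2 hc) hβ) hθ (-y / β)
  have hsin := norm_inv_Gamma_neg_mul_Gamma_one_add_le (linePoint c y)
  rw [linePoint_im] at hsin
  have hfactor : stableMellin A β (linePoint c y) / Gamma (1 + linePoint c y) =
      (A : ℂ) ^ linePoint (c / β) (y / β) * (Gamma (linePoint (-c / β) (-y / β)) *
        (Gamma (-linePoint c y) * Gamma (1 + linePoint c y))⁻¹) := by
    rw [stableMellin, ← linePoint_div, ← linePoint_div, ← neg_linePoint]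
    simp only [div_eq_mul_inv, mul_inv]
    ring
  have hexp : Real.exp (-((θ / β - π) * |y|)) =
      Real.exp (-(θ * |(-y / β)|)) * Real.exp (π * |y|) := by
    rw [← Real.exp_add, abs_div, abs_neg, abs_of_pos hβ]
    ring_nf
  rw [hfactor, norm_mul, norm_mul, norm_cpow_linePoint hA, hexp, mul_assoc,
    ← mul_assoc (gammaBound _ _)]
  gcongr
  exact (norm_nonneg _).trans hΓ

lemma integrable_stableMellin_linePoint (hA : 0 < A) (hβ : 0 < β) (hβ1 : β < 1) (hc : c < 0)
    (hc1 : -1 < c) : Integrable fun y => stableMellin A β (linePoint c y) := by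
  obtain ⟨θ, η, hθ0, hθ, hη0, -, hrate⟩ := exists_pi_lt_div_add_mul hβ hβ1
  have hc1' : 0 < 1 + c := by linarith
  have hδ : 0 < θ / β + θ - π := by linarith [mul_pos hη0 hθ0]
  have hbound : 0 < gammaBound (-c / β) θ := gammaBound_pos (div_pos (neg_pos.2 hc) hβ) hθ
  refine ((integrable_exp_neg_mul_abs hδ).const_mul
    (A ^ (c / β) * gammaBound (-c / β) θ * gammaBound (1 + c) θ)).mono'
    (continuous_stableMellin_linePoint hA hβ hc).aestronglyMeasurable
    (Eventually.of_forall fun y => ?_)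
  have hne : Gamma (1 + linePoint c y) ≠ 0 := Gamma_ne_zero_of_re_pos (by simpa using hc1')
  have hexp : Real.exp (-((θ / β + θ - π) * |y|)) =
      Real.exp (-((θ / β - π) * |y|)) * Real.exp (-(θ * |y|)) := by
    rw [← Real.exp_add]
    ring_nf
  rw [← div_mul_cancel₀ (stableMellin A β (linePoint c y)) hne, norm_mul, hexp]
  refine (mul_le_mul (norm_stableMellin_div_Gamma_one_add_le hA hβ hc hθ y)
    (one_add_linePoint c y ▸ norm_Gamma_linePoint_le hc1' hθ y) (norm_nonneg _)
    (by positivity)).trans_eq ?_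
  ring

lemma continuous_coupledFactor {M : ℂ → ℂ} (hM : Continuous fun y => M (linePoint c y))
    (hσ : 0 < σ) (hσc : σ < 1 + c) : Continuous (coupledFactor M c σ) := by
  unfold coupledFactor
  simp_rw [one_add_linePoint, linePoint_sub, div_eq_mul_inv]
  refine ((hM.comp continuous_fst).mul (continuous_inv_Gamma.comp (by fun_prop))).mul
    (((continuous_Gamma_linePoint hσ).comp continuous_snd).mul ?_)
  exact (continuous_Gamma_linePoint (sub_pos.2 hσc)).comp
    (by fun_prop : Continuous fun p : ℝ × ℝ => p.1 - p.2)

lemma integrable_coupledFactor_stableMellin (hA : 0 < A) (hβ : 0 < β) (hβ1 : β < 1) (hc : c < 0)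
    (hσ : 0 < σ) (hσc : σ < 1 + c) : Integrable (coupledFactor (stableMellin A β) c σ) := by
  obtain ⟨θ, η, hθ0, hθ, hη0, hη1, hrate⟩ := exists_pi_lt_div_add_mul hβ hβ1
  have hδ : 0 < θ / β + (1 - η) * θ - π := by linarith
  refine (((integrable_exp_neg_mul_abs hδ).mul_prod
    (integrable_exp_neg_mul_abs (mul_pos hη0 hθ0))).const_mul (A ^ (c / β) *
      gammaBound (-c / β) θ * (gammaBound σ θ * gammaBound (1 + c - σ) θ))).mono'
    (continuous_coupledFactor (continuous_stableMellin_linePoint hA hβ hc) hσ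
      hσc).aestronglyMeasurable (Eventually.of_forall fun ⟨y, w⟩ => ?_)
  have htriangle : (1 - η) * |y| + η * |w| ≤ |w| + |y - w| := by
    have := abs_add_le w (y - w)
    rw [add_sub_cancel] at this
    nlinarith [abs_nonneg (y - w)]
  have hexp : Real.exp (-((θ / β - π) * |y|)) *
      (Real.exp (-(θ * |w|)) * Real.exp (-(θ * |y - w|))) ≤
      Real.exp (-((θ / β + (1 - η) * θ - π) * |y|)) * Real.exp (-(η * θ * |w|)) := by
    rw [← Real.exp_add, ← Real.exp_add, ← Real.exp_add, Real.exp_le_exp]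
    linarith [mul_le_mul_of_nonneg_left htriangle hθ0.le]
  have hbound : 0 < gammaBound (-c / β) θ := gammaBound_pos (div_pos (neg_pos.2 hc) hβ) hθ
  have hboundσ := gammaBound_pos hσ hθ
  have hboundσc := gammaBound_pos (sub_pos.2 hσc) hθ
  have hΓ : ‖Gamma (1 + linePoint c y - linePoint σ w)‖ ≤
      gammaBound (1 + c - σ) θ * Real.exp (-(θ * |y - w|)) := by
    rw [one_add_linePoint, linePoint_sub]
    exact norm_Gamma_linePoint_le (sub_pos.2 hσc) hθ (y - w)
  rw [coupledFactor, norm_mul, norm_mul]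
  refine (mul_le_mul (norm_stableMellin_div_Gamma_one_add_le hA hβ hc hθ y)
    (mul_le_mul (norm_Gamma_linePoint_le hσ hθ w) hΓ (norm_nonneg _) (by positivity))
    (by positivity) (by positivity)).trans ?_
  rw [mul_mul_mul_comm (gammaBound σ θ), mul_mul_mul_comm]
  exact mul_le_mul_of_nonneg_left hexp (by positivity)

end StableMellin

end GammaFunction

/-! ### The characteristic exponent of the one-sided tempered stable law -/

section LevyExponent

open Complex Set

lemma hasDerivAt_integral_cexp_sub_one_mul {ν : Measure ℝ} {w : ℝ → ℂ}
    (hw : AEStronglyMeasurable w ν) (hxw : Integrable (fun x : ℝ => x * w x) ν) (u : ℝ) :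
    HasDerivAt (fun u : ℝ => ∫ x, (cexp (I * u * x) - 1) * w x ∂ν)
      (∫ x, I * cexp (I * u * x) * (x * w x) ∂ν) u := by
  have hnorm (u x : ℝ) : ‖cexp (I * u * x) - 1‖ ≤ |u| * |x| := by
    have h := Real.norm_exp_I_mul_ofReal_sub_one_le (x := u * x)
    rwa [ofReal_mul, ← mul_assoc, Real.norm_eq_abs, abs_mul] at h
  have hmeas (u : ℝ) : AEStronglyMeasurable (fun x : ℝ => (cexp (I * u * x) - 1) * w x) ν :=
    (Continuous.aestronglyMeasurable (by fun_prop)).mul hw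
  refine (hasDerivAt_integral_of_dominated_loc_of_deriv_le (s := univ) (x₀ := u)
    (F' := fun (u x : ℝ) => I * cexp (I * u * x) * (x * w x)) (bound := fun x => ‖x * w x‖)
    Filter.univ_mem (.of_forall hmeas) ((hxw.norm.const_mul |u|).mono' (hmeas u) ?_)
    ((Continuous.aestronglyMeasurable (by fun_prop)).mul hxw.1) ?_ hxw.norm ?_).2
  · refine .of_forall fun x => ?_
    rw [norm_mul, norm_mul, norm_real, Real.norm_eq_abs, ← mul_assoc]
    gcongr
    exact hnorm u x
  · refine .of_forall fun x u _ => ?_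
    rw [norm_mul, norm_mul, norm_I, one_mul, norm_exp]
    simp
  · refine .of_forall fun x u _ => ?_
    have hexp : HasDerivAt (fun u : ℝ => cexp (I * u * x)) (cexp (I * u * x) * (I * 1 * x)) u :=
      (((hasDerivAt_id u).ofReal_comp.const_mul I).mul_const (x : ℂ)).cexp
    exact ((hexp.sub_const 1).mul_const _).congr_deriv (by ring)

lemma mul_levyDensityTSPlus (α β lam x : ℝ) :
    x * levyDensityTSPlus α β lam x
      = (Ioi 0).indicator (fun x => α * (x ^ (-β) * Real.exp (-(lam * x)))) x := by
  by_cases hx : x ∈ Ioi 0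
  · have hx0 : x ≠ 0 := ne_of_gt hx
    rw [levyDensityTSPlus, indicator_of_mem hx, indicator_of_mem hx, Real.rpow_add hx,
      Real.rpow_one, Real.rpow_neg (le_of_lt hx), neg_mul]
    field_simp
  · rw [levyDensityTSPlus, indicator_of_notMem hx, indicator_of_notMem hx, mul_zero]

lemma integrable_mul_levyDensityTSPlus {α β lam : ℝ} (hβ1 : β < 1) (hlam : 0 < lam) :
    Integrable (fun x => x * levyDensityTSPlus α β lam x) := by
  simp only [mul_levyDensityTSPlus]
  rw [integrable_indicator_iff measurableSet_Ioi]
  exact (integrableOn_rpow_mul_exp_neg_mul (by linarith) hlam).const_mul α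

lemma integral_cexp_mul_levyDensityTSPlus {α β lam : ℝ} (hβ1 : β < 1) (hlam : 0 < lam) (u : ℝ) :
    ∫ x : ℝ, I * cexp (I * u * x) * (x * (levyDensityTSPlus α β lam x : ℂ))
      = I * α * ((lam - I * u : ℂ) ^ (-(1 - β : ℂ)) * Gamma (1 - β)) := by
  rw [← integral_cpow_mul_cexp_Ioi (by simpa using hβ1) (by simpa using hlam),
    ← integral_const_mul, ← integral_indicator measurableSet_Ioi]
  congr 1 with x
  rw [← ofReal_mul, mul_levyDensityTSPlus]
  by_cases hx : x ∈ Ioi 0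
  · rw [indicator_of_mem hx, indicator_of_mem hx,
      show -((lam - I * u) * x) = I * u * x + ((-(lam * x) : ℝ) : ℂ) by push_cast; ring, exp_add,
      show (1 - β - 1 : ℂ) = ((-β : ℝ) : ℂ) by push_cast; ring, ← ofReal_cpow (le_of_lt hx)]
    push_cast
    ring
  · rw [indicator_of_notMem hx, indicator_of_notMem hx, ofReal_zero, mul_zero]

lemma hasDerivAt_ofReal_mul_Gamma_mul_cpow {β lam : ℝ} (hβ : β ≠ 0) (hlam : 0 < lam) (u : ℝ) :
    HasDerivAt (fun u : ℝ => Gamma (-β) * ((lam - I * u : ℂ) ^ (β : ℂ) - (lam : ℂ) ^ (β : ℂ)))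
      (I * ((lam - I * u : ℂ) ^ (-(1 - β : ℂ)) * Gamma (1 - β))) u := by
  have hlin : HasDerivAt (fun u : ℝ => (lam - I * u : ℂ)) (-(I * 1)) u :=
    ((hasDerivAt_id u).ofReal_comp.const_mul I).const_sub (lam : ℂ)
  have hpow : HasDerivAt (fun z : ℂ => z ^ (β : ℂ)) (β * (lam - I * u : ℂ) ^ (β - 1 : ℂ) * 1)
      (lam - I * u : ℂ) := (hasDerivAt_id _).cpow_const (Or.inl (by simpa using hlam))
  refine (((hpow.comp u hlin).sub_const _).const_mul (Gamma (-β))).congr_deriv ?_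
  rw [show (1 - β : ℂ) = -β + 1 by ring, Gamma_add_one _ (by simpa using hβ),
    show (-(-β + 1) : ℂ) = β - 1 by ring]
  ring

lemma integral_levyDensityTSPlus {α β lam : ℝ} (hβ : β ≠ 0) (hβ1 : β < 1) (hlam : 0 < lam)
    (u : ℝ) :
    ∫ x : ℝ, (cexp (I * u * x) - 1) * (levyDensityTSPlus α β lam x : ℂ)
      = α * (Gamma (-β) * ((lam - I * u : ℂ) ^ (β : ℂ) - (lam : ℂ) ^ (β : ℂ))) := by
  have hmeas : Measurable (levyDensityTSPlus α β lam) := by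
    unfold levyDensityTSPlus
    exact Measurable.indicator (by fun_prop) measurableSet_Ioi
  have hint : Integrable (fun x : ℝ => (x : ℂ) * (levyDensityTSPlus α β lam x : ℂ)) := by
    simpa using (integrable_mul_levyDensityTSPlus (α := α) hβ1 hlam).ofReal (𝕜 := ℂ)
  have hderiv (v : ℝ) : HasDerivAt (fun u : ℝ =>
      (∫ x : ℝ, (cexp (I * u * x) - 1) * (levyDensityTSPlus α β lam x : ℂ))
        - α * (Gamma (-β) * ((lam - I * u : ℂ) ^ (β : ℂ) - (lam : ℂ) ^ (β : ℂ)))) 0 v := by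
    refine ((hasDerivAt_integral_cexp_sub_one_mul (by fun_prop) hint v).sub
      ((hasDerivAt_ofReal_mul_Gamma_mul_cpow hβ hlam v).const_mul (α : ℂ))).congr_deriv ?_
    rw [integral_cexp_mul_levyDensityTSPlus hβ1 hlam]
    ring
  have hconst := is_const_of_deriv_eq_zero (fun v => (hderiv v).differentiableAt)
    (fun v => (hderiv v).deriv) u 0
  simp only [ofReal_zero, mul_zero, sub_zero, zero_mul, exp_zero, sub_self, integral_zero] at hconst
  exact sub_eq_zero.1 hconst

end LevyExponent

/-! ### Laplace transforms of measures on the half line -/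

section NonnegativeSupport

open Complex Set Filter Topology

lemma eq_zero_of_bounded_of_forall_mul_I_eq_zero {f : ℂ → ℂ} {B : ℝ}
    (hf : DiffContOnCl ℂ f {z | z.re < 0}) (hB : ∀ z : ℂ, z.re ≤ 0 → ‖f z‖ ≤ B)
    (hI : ∀ x : ℝ, f (x * I) = 0) {z : ℂ} (hz : z.re ≤ 0) : f z = 0 := by
  have hneg : DiffContOnCl ℂ (fun z => f (-z)) {z | 0 < z.re} :=
    hf.comp differentiable_neg.diffContOnCl fun z hz => by simpa using hz
  have hBneg (z : ℂ) (hz : 0 ≤ z.re) : ‖f (-z)‖ ≤ B := hB _ (by simpa using hz)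
  have hle := PhragmenLindelof.right_half_plane_of_bounded_on_real (C := 0) (z := -z) hneg
    ⟨1, by norm_num, 0, ?_⟩ ⟨B, ?_⟩ (fun x => ?_) (by simpa using hz)
  · simpa using hle
  · refine Asymptotics.IsBigO.of_bound B (Eventually.filter_mono inf_le_right
      (eventually_principal.2 fun z hz => ?_))
    simpa using hBneg z (le_of_lt hz)
  · rw [eventually_map]
    filter_upwards [eventually_ge_atTop 0] with x hx
    exact hBneg x (by simpa using hx)
  · rw [← neg_mul, ← ofReal_neg, hI, norm_zero]

lemma hasSum_mgf_add {μ : Measure ℝ} (hμ : ∀ᵐ x ∂μ, 0 ≤ x) {t r : ℝ}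
    (ht : t ∈ interior (integrableExpSet id μ)) (hr : 0 ≤ r)
    (hsum : Summable fun n : ℕ => r ^ n / n.factorial * ∫ x, x ^ n * Real.exp (t * x) ∂μ) :
    HasSum (fun n : ℕ => r ^ n / n.factorial * ∫ x, x ^ n * Real.exp (t * x) ∂μ)
      (mgf id μ (t + r)) := by
  have hint (n : ℕ) :
      Integrable (fun x => r ^ n / n.factorial * (x ^ n * Real.exp (t * x))) μ :=
    (integrable_pow_mul_exp_of_mem_interior_integrableExpSet (X := id) ht n).const_mul _
  have hnorm (n : ℕ) : ∫ x, ‖r ^ n / n.factorial * (x ^ n * Real.exp (t * x))‖ ∂μ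
      = r ^ n / n.factorial * ∫ x, x ^ n * Real.exp (t * x) ∂μ := by
    rw [← integral_const_mul]
    refine integral_congr_ae ?_
    filter_upwards [hμ] with x hx
    exact Real.norm_of_nonneg (by positivity)
  have hexp (x : ℝ) : HasSum (fun n : ℕ => r ^ n / n.factorial * (x ^ n * Real.exp (t * x)))
      (Real.exp ((t + r) * x)) := by
    have h := (NormedSpace.expSeries_div_hasSum_exp (r * x)).mul_right (Real.exp (t * x))
    rw [← Real.exp_eq_exp_ℝ, ← Real.exp_add, ← add_mul, add_comm r t] at h
    exact h.congr_fun fun n => by ring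
  have hswap := hasSum_integral_of_summable_integral_norm hint (hsum.congr fun n => (hnorm n).symm)
  simp only [integral_const_mul, fun x => (hexp x).tsum_eq] at hswap
  exact hswap

variable {μ : Measure ℝ} [IsFiniteMeasure μ]

lemma Iic_zero_subset_integrableExpSet_of_ae_nonneg (hμ : ∀ᵐ x ∂μ, 0 ≤ x) :
    Iic 0 ⊆ integrableExpSet id μ := by
  intro t ht
  refine (integrable_const (1 : ℝ)).mono' (by fun_prop) ?_
  filter_upwards [hμ] with x hx
  rw [Real.norm_of_nonneg (Real.exp_pos _).le]
  exact Real.exp_le_one_iff.2 (mul_nonpos_of_nonpos_of_nonneg ht hx)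

lemma mem_interior_integrableExpSet_of_ae_nonneg (hμ : ∀ᵐ x ∂μ, 0 ≤ x) {t : ℝ} (ht : t < 0) :
    t ∈ interior (integrableExpSet id μ) :=
  interior_mono (Iic_zero_subset_integrableExpSet_of_ae_nonneg hμ) (by rwa [interior_Iic])

lemma norm_complexMGF_le_of_ae_nonneg (hμ : ∀ᵐ x ∂μ, 0 ≤ x) {z : ℂ} (hz : z.re ≤ 0) :
    ‖complexMGF id μ z‖ ≤ μ.real univ := by
  have hmgf : mgf id μ z.re ≤ ∫ _, (1 : ℝ) ∂μ := by
    refine integral_mono_ae (Iic_zero_subset_integrableExpSet_of_ae_nonneg hμ hz)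
      (integrable_const _) ?_
    filter_upwards [hμ] with x hx
    exact Real.exp_le_one_iff.2 (mul_nonpos_of_nonpos_of_nonneg hz hx)
  exact norm_complexMGF_le_mgf.trans (by simpa using hmgf)

lemma diffContOnCl_complexMGF_of_ae_nonneg (hμ : ∀ᵐ x ∂μ, 0 ≤ x) :
    DiffContOnCl ℂ (complexMGF id μ) {z | z.re < 0} := by
  refine ⟨fun z hz => (hasDerivAt_complexMGF
    (mem_interior_integrableExpSet_of_ae_nonneg hμ hz)).differentiableAt.differentiableWithinAt, ?_⟩
  rw [closure_setOfPred_re_lt]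
  refine continuousOn_of_dominated (bound := fun _ => 1) (fun z _ => by fun_prop) (fun z hz => ?_)
    (integrable_const _) (.of_forall fun x => by fun_prop)
  filter_upwards [hμ] with x hx
  rw [norm_exp]
  exact Real.exp_le_one_iff.2 (by simpa using mul_nonpos_of_nonpos_of_nonneg hz hx)

lemma complexMGF_eq_of_charFun_eq (hμ : ∀ᵐ x ∂μ, 0 ≤ x) {F : ℂ → ℂ} {B : ℝ}
    (hF : DiffContOnCl ℂ F {z | z.re < 0}) (hB : ∀ z : ℂ, z.re ≤ 0 → ‖F z‖ ≤ B)
    (hcharFun : ∀ u : ℝ, charFun μ u = F (u * I)) {z : ℂ} (hz : z.re ≤ 0) :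
    complexMGF id μ z = F z := by
  refine sub_eq_zero.1 (eq_zero_of_bounded_of_forall_mul_I_eq_zero (B := μ.real univ + B)
    (f := fun z => complexMGF id μ z - F z) ((diffContOnCl_complexMGF_of_ae_nonneg hμ).sub hF)
    (fun z hz => (norm_sub_le _ _).trans
      (add_le_add (norm_complexMGF_le_of_ae_nonneg hμ hz) (hB z hz))) (fun x => ?_) hz)
  rw [complexMGF_id_mul_I, hcharFun, sub_self]

/-- The Taylor series of `F` at `-1` has nonnegative terms to the right of `-1`, so that it can be
compared with the termwise integrated exponential series. -/
lemma ofReal_mgf_eq_of_differentiableOn (hμ : ∀ᵐ x ∂μ, 0 ≤ x) {F : ℂ → ℂ} {lam : ℝ}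
    (hF : DifferentiableOn ℂ F {z | z.re < lam})
    (hFμ : ∀ z : ℂ, z.re < 0 → complexMGF id μ z = F z) {t : ℝ} (ht : t < lam) :
    (mgf id μ t : ℂ) = F t := by
  rcases lt_or_ge t 0 with ht0 | ht0
  · rw [← complexMGF_ofReal, hFμ _ (by simpa using ht0)]
  have hball : Metric.ball (-1 : ℂ) (1 + lam) ⊆ {z | z.re < lam} := fun z hz => by
    have hre := (re_le_norm (z - (-1))).trans_lt (mem_ball_iff_norm.1 hz)
    simp only [sub_neg_eq_add, add_re, one_re] at hre
    exact show z.re < lam by linarith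
  have htball : (t : ℂ) ∈ Metric.ball (-1 : ℂ) (1 + lam) := by
    rw [mem_ball_iff_norm, sub_neg_eq_add, ← ofReal_one, ← ofReal_add, norm_real,
      Real.norm_of_nonneg (by linarith)]
    linarith
  have hev : F =ᶠ[𝓝 (-1)] complexMGF id μ := by
    filter_upwards [(isOpen_lt continuous_re continuous_const).mem_nhds
      (show (-1 : ℂ).re < 0 by simp)] with z hz using (hFμ z hz).symm
  have htaylor := hasSum_taylorSeries_on_ball (hF.mono hball) htball
  have hterm (n : ℕ) : (n.factorial : ℂ)⁻¹ • (t - (-1) : ℂ) ^ n • iteratedDeriv n F (-1)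
      = (((t + 1) ^ n / n.factorial * ∫ x, x ^ n * Real.exp (-1 * x) ∂μ : ℝ) : ℂ) := by
    rw [hev.iteratedDeriv_eq n, iteratedDeriv_complexMGF
      (by simpa using mem_interior_integrableExpSet_of_ae_nonneg hμ neg_one_lt_zero) n, ofReal_mul,
      ← integral_complex_ofReal]
    simp only [smul_eq_mul, id]
    push_cast
    ring
  simp only [hterm] at htaylor
  have hsum := hasSum_mgf_add hμ (mem_interior_integrableExpSet_of_ae_nonneg hμ neg_one_lt_zero)
    (by linarith) (summable_ofReal.1 htaylor.summable)
  rw [htaylor.unique (hasSum_ofReal.2 hsum)]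
  simp

lemma measure_singleton_zero_of_tendsto_mgf_atBot (hμ : ∀ᵐ x ∂μ, 0 ≤ x)
    (htend : Tendsto (mgf id μ) atBot (𝓝 0)) : μ {0} = 0 := by
  have hle (t : ℝ) (ht : t ≤ 0) : μ.real {0} ≤ mgf id μ t := by
    rw [← integral_indicator_one (measurableSet_singleton 0)]
    refine integral_mono ((integrable_const 1).indicator (measurableSet_singleton 0))
      (Iic_zero_subset_integrableExpSet_of_ae_nonneg hμ ht) fun x => ?_
    by_cases hx : x = 0
    · simp [hx]
    · simp [hx, Real.exp_nonneg]
  rw [← measureReal_eq_zero_iff]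
  refine le_antisymm (ge_of_tendsto htend ?_) measureReal_nonneg
  filter_upwards [eventually_le_atBot 0] with t ht using hle t ht

end NonnegativeSupport

section ExpTilt

open Complex Set Filter

/-- The measure `e ^ (lam x) μ(dx)`. It is not normalised, and it may be infinite: tilting the law
`TS₊(α, β, lam)` in this way gives a multiple of a stable law, even though `e ^ (lam x)` is the
borderline exponential moment. -/
noncomputable def expTilt (μ : Measure ℝ) (lam : ℝ) : Measure ℝ :=
  μ.withDensity fun x => ENNReal.ofReal (Real.exp (lam * x))

instance (μ : Measure ℝ) [SigmaFinite μ] (lam : ℝ) : SigmaFinite (expTilt μ lam) :=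
  SigmaFinite.withDensity_of_ne_top (by simp)

lemma integral_expTilt {E : Type*} [NormedAddCommGroup E] [NormedSpace ℝ E] (μ : Measure ℝ)
    (lam : ℝ) (f : ℝ → E) : ∫ x, f x ∂(expTilt μ lam) = ∫ x, Real.exp (lam * x) • f x ∂μ := by
  rw [expTilt, integral_withDensity_eq_integral_toReal_smul (by fun_prop) (by simp)]
  simp only [ENNReal.toReal_ofReal (Real.exp_pos _).le]

lemma integrable_expTilt_iff {E : Type*} [NormedAddCommGroup E] [NormedSpace ℝ E] {μ : Measure ℝ}
    {lam : ℝ} {f : ℝ → E} :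
    Integrable f (expTilt μ lam) ↔ Integrable (fun x => Real.exp (lam * x) • f x) μ := by
  rw [expTilt, integrable_withDensity_iff_integrable_smul' (by fun_prop) (by simp)]
  simp only [ENNReal.toReal_ofReal (Real.exp_pos _).le]

lemma ae_expTilt_of_ae {μ : Measure ℝ} {p : ℝ → Prop} (h : ∀ᵐ x ∂μ, p x) (lam : ℝ) :
    ∀ᵐ x ∂(expTilt μ lam), p x :=
  (withDensity_absolutelyContinuous _ _).ae_le h

end ExpTilt

section NegativeMoments

open Complex Set Filter

variable {ρ : Measure ℝ}

lemma integrable_cpow_mul_exp_neg_mul [SFinite ρ] {w : ℂ}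
    (hexp : ∀ p > 0, Integrable (fun x => Real.exp (-(p * x))) ρ)
    (hw : IntegrableOn (fun p => p ^ (w.re - 1) * ∫ x, Real.exp (-(p * x)) ∂ρ) (Ioi 0)) :
    Integrable (Function.uncurry fun p x : ℝ => (p : ℂ) ^ (w - 1) * (Real.exp (-(p * x)) : ℂ))
      ((volume.restrict (Ioi 0)).prod ρ) := by
  have hmeas : Measurable
      (Function.uncurry fun p x : ℝ => (p : ℂ) ^ (w - 1) * (Real.exp (-(p * x)) : ℂ)) := by
    simp only [Function.uncurry_def]
    fun_prop
  refine (integrable_prod_iff hmeas.aestronglyMeasurable).2 ⟨?_, hw.congr ?_⟩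
  · filter_upwards [ae_restrict_mem measurableSet_Ioi] with p hp
    exact ((hexp p hp).ofReal (𝕜 := ℂ)).const_mul ((p : ℂ) ^ (w - 1))
  · filter_upwards [ae_restrict_mem measurableSet_Ioi] with p hp
    rw [← integral_const_mul]
    refine integral_congr_ae (.of_forall fun x => ?_)
    simp [norm_cpow_eq_rpow_re_of_pos (mem_Ioi.1 hp), -ofReal_exp]

/-- Fubini's theorem applied to Euler's integral `Γ(w) x ^ (-w) = ∫ p ^ (w - 1) e ^ (-p x) dp`. -/
lemma integral_cpow_neg_mul_Gamma [SFinite ρ] {w : ℂ} (hρ : ∀ᵐ x ∂ρ, 0 < x) (hw : 0 < w.re)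
    (hexp : ∀ p > 0, Integrable (fun x => Real.exp (-(p * x))) ρ)
    (hint : IntegrableOn (fun p => p ^ (w.re - 1) * ∫ x, Real.exp (-(p * x)) ∂ρ) (Ioi 0)) :
    Integrable (fun x : ℝ => (x : ℂ) ^ (-w)) ρ ∧
    (∫ x : ℝ, (x : ℂ) ^ (-w) ∂ρ) * Gamma w
      = ∫ p : ℝ in Ioi 0, (p : ℂ) ^ (w - 1) * ((∫ x, Real.exp (-(p * x)) ∂ρ : ℝ) : ℂ) := by
  have hprod := integrable_cpow_mul_exp_neg_mul hexp hint
  have hΓ : Gamma w ≠ 0 := Gamma_ne_zero_of_re_pos hw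
  have hEuler : ∀ᵐ x : ℝ ∂ρ, ∫ p : ℝ in Ioi 0, (p : ℂ) ^ (w - 1) * (Real.exp (-(p * x)) : ℂ)
      = (x : ℂ) ^ (-w) * Gamma w := by
    filter_upwards [hρ] with x hx
    rw [← integral_cpow_mul_cexp_Ioi hw (show 0 < (x : ℂ).re from hx)]
    push_cast
    simp only [mul_comm (x : ℂ)]
  constructor
  · simpa only [mul_assoc, mul_inv_cancel₀ hΓ, mul_one] using
      (hprod.integral_prod_right.congr hEuler).mul_const (Gamma w)⁻¹
  · rw [← integral_mul_const, ← integral_congr_ae hEuler, ← integral_integral_swap hprod]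
    simp only [integral_const_mul, integral_complex_ofReal]

end NegativeMoments

/-! ### The one-sided tempered stable law -/

section TemperedStable

open Complex Set Filter Topology

lemma tsA_pos {α β : ℝ} (hα : 0 < α) (hβ : 0 < β) (hβ1 : β < 1) : 0 < tsA α β := by
  have hΓ : 0 < -β * Real.Gamma (-β) := by
    rw [← Real.Gamma_add_one (by linarith)]
    exact Real.Gamma_pos_of_pos (by linarith)
  have hneg : Real.Gamma (-β) < 0 := by nlinarith
  unfold tsA
  nlinarith

lemma re_cpow_ofReal_nonneg {w : ℂ} {β : ℝ} (hβ : 0 ≤ β) (hβ1 : β ≤ 1) (hw : 0 ≤ w.re) :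
    0 ≤ (w ^ (β : ℂ)).re := by
  rw [cpow_ofReal_re]
  refine mul_nonneg (by positivity) (Real.cos_nonneg_of_mem_Icc (abs_le.1 ?_))
  calc |arg w * β| = |arg w| * β := by rw [abs_mul, abs_of_nonneg hβ]
    _ ≤ Real.pi / 2 * 1 := mul_le_mul (abs_arg_le_pi_div_two_iff.2 hw) hβ1 hβ (by positivity)
    _ = Real.pi / 2 := mul_one _

/-- The moment generating function of the law `TS₊(α, β, lam)` with `A = -α Γ(-β)`, continued
analytically to `re z < lam`. -/
noncomputable def tsMGF (A β lam : ℝ) (z : ℂ) : ℂ :=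
  cexp (A * (lam : ℂ) ^ (β : ℂ) - A * (lam - z) ^ (β : ℂ))

lemma differentiableOn_tsMGF (A β lam : ℝ) :
    DifferentiableOn ℂ (tsMGF A β lam) {z | z.re < lam} := by
  intro z hz
  refine DifferentiableAt.differentiableWithinAt (DifferentiableAt.cexp
    ((differentiableAt_const _).sub (DifferentiableAt.const_mul
      (DifferentiableAt.cpow_const (by fun_prop) (Or.inl ?_)) _)))
  simpa using hz

lemma norm_tsMGF_le {A β lam : ℝ} (hA : 0 ≤ A) (hβ : 0 ≤ β) (hβ1 : β ≤ 1) {z : ℂ}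
    (hz : z.re ≤ lam) : ‖tsMGF A β lam z‖ ≤ Real.exp ((A * (lam : ℂ) ^ (β : ℂ)).re) := by
  rw [tsMGF, norm_exp, Real.exp_le_exp, sub_re, re_ofReal_mul A ((lam - z) ^ (β : ℂ))]
  exact sub_le_self _ (mul_nonneg hA (re_cpow_ofReal_nonneg hβ hβ1 (by simpa using hz)))

lemma tsMGF_ofReal {A β lam t : ℝ} (hlam : 0 ≤ lam) (ht : t ≤ lam) :
    tsMGF A β lam t = ((Real.exp (A * lam ^ β - A * (lam - t) ^ β) : ℝ) : ℂ) := by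
  rw [tsMGF, ← ofReal_sub, ← ofReal_cpow hlam, ← ofReal_cpow (sub_nonneg.2 ht)]
  push_cast
  rfl

namespace IsTSPlus

variable {μ : Measure ℝ} {α β lam : ℝ}

lemma ae_nonneg (h : IsTSPlus μ α β lam) : ∀ᵐ x ∂μ, 0 ≤ x := by
  rw [ae_iff]
  simp only [not_le]
  exact h.support

lemma charFun_eq_tsMGF (h : IsTSPlus μ α β lam) (hβ : β ≠ 0) (hβ1 : β < 1) (hlam : 0 < lam)
    (u : ℝ) : charFun μ u = tsMGF (tsA α β) β lam (u * I) := by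
  rw [h.charFun_eq, integral_levyDensityTSPlus hβ hβ1 hlam, tsMGF, tsA, mul_comm I, ofReal_mul,
    ← Gamma_ofReal]
  congr 1
  push_cast
  ring

lemma mgf_eq (h : IsTSPlus μ α β lam) (hα : 0 < α) (hβ : 0 < β) (hβ1 : β < 1) (hlam : 0 < lam)
    {t : ℝ} (ht : t < lam) :
    mgf id μ t = Real.exp (tsA α β * lam ^ β - tsA α β * (lam - t) ^ β) := by
  have := h.isProb
  have hdiffCont : DiffContOnCl ℂ (tsMGF (tsA α β) β lam) {z | z.re < 0} := by
    refine ((differentiableOn_tsMGF _ _ _).mono ?_).diffContOnCl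
    rw [closure_setOfPred_re_lt]
    exact fun z (hz : z.re ≤ 0) => hz.trans_lt hlam
  have hcontinued (z : ℂ) (hz : z.re < 0) : complexMGF id μ z = tsMGF (tsA α β) β lam z :=
    complexMGF_eq_of_charFun_eq h.ae_nonneg hdiffCont
      (fun z hz => norm_tsMGF_le (tsA_pos hα hβ hβ1).le hβ.le hβ1.le (hz.trans hlam.le))
      (h.charFun_eq_tsMGF hβ.ne' hβ1 hlam) hz.le
  have heq := ofReal_mgf_eq_of_differentiableOn h.ae_nonneg (differentiableOn_tsMGF _ _ _)
    hcontinued ht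
  rwa [tsMGF_ofReal hlam.le ht.le, ofReal_inj] at heq

lemma integrable_exp_mul (h : IsTSPlus μ α β lam) (hα : 0 < α) (hβ : 0 < β) (hβ1 : β < 1)
    (hlam : 0 < lam) {t : ℝ} (ht : t < lam) : Integrable (fun x => Real.exp (t * x)) μ :=
  .of_integral_ne_zero (ne_of_eq_of_ne (h.mgf_eq hα hβ hβ1 hlam ht) (Real.exp_pos _).ne')

lemma ae_pos (h : IsTSPlus μ α β lam) (hα : 0 < α) (hβ : 0 < β) (hβ1 : β < 1) (hlam : 0 < lam) :
    ∀ᵐ x ∂μ, 0 < x := by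
  have := h.isProb
  have hpow : Tendsto (fun t : ℝ => (lam - t) ^ β) atBot atTop :=
    (tendsto_rpow_atTop hβ).comp (tendsto_atTop_add_const_left _ lam tendsto_neg_atBot_atTop)
  have htend : Tendsto (mgf id μ) atBot (𝓝 0) := by
    refine (Real.tendsto_exp_atBot.comp (tendsto_atBot_add_const_left _ (tsA α β * lam ^ β)
      (tendsto_neg_atTop_atBot.comp (hpow.const_mul_atTop (tsA_pos hα hβ hβ1))))).congr' ?_
    filter_upwards [eventually_lt_atBot lam] with t ht
    exact (h.mgf_eq hα hβ hβ1 hlam ht).symm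
  have hne : ∀ᵐ x ∂μ, x ≠ 0 := by
    simpa [ae_iff] using measure_singleton_zero_of_tendsto_mgf_atBot h.ae_nonneg htend
  filter_upwards [h.ae_nonneg, hne] with x hx hx0 using lt_of_le_of_ne hx hx0.symm

lemma integrable_exp_neg_expTilt (h : IsTSPlus μ α β lam) (hα : 0 < α) (hβ : 0 < β)
    (hβ1 : β < 1) (hlam : 0 < lam) {p : ℝ} (hp : 0 < p) :
    Integrable (fun x => Real.exp (-(p * x))) (expTilt μ lam) := by
  rw [integrable_expTilt_iff]
  refine (h.integrable_exp_mul hα hβ hβ1 hlam (sub_lt_self lam hp)).congr (.of_forall fun x => ?_)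
  simp only [smul_eq_mul]
  rw [← Real.exp_add, sub_mul, sub_eq_add_neg]

lemma integral_exp_neg_expTilt (h : IsTSPlus μ α β lam) (hα : 0 < α) (hβ : 0 < β)
    (hβ1 : β < 1) (hlam : 0 < lam) {p : ℝ} (hp : 0 < p) :
    ∫ x, Real.exp (-(p * x)) ∂(expTilt μ lam)
      = Real.exp (tsA α β * lam ^ β) * Real.exp (-(tsA α β * p ^ β)) := by
  have hmgf := h.mgf_eq hα hβ hβ1 hlam (sub_lt_self lam hp)
  rw [sub_sub_cancel, sub_eq_add_neg (tsA α β * lam ^ β), Real.exp_add] at hmgf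
  rw [← hmgf, integral_expTilt, mgf]
  refine integral_congr_ae (.of_forall fun x => ?_)
  simp only [smul_eq_mul, id]
  rw [← Real.exp_add, sub_mul, sub_eq_add_neg]

end IsTSPlus

lemma integral_cpow_mul_exp_neg_rpow {A β : ℝ} (hA : 0 < A) (hβ : 0 < β) {w : ℂ} (hw : 0 < w.re) :
    ∫ p : ℝ in Ioi 0, (p : ℂ) ^ (w - 1) * (Real.exp (-(A * p ^ β)) : ℂ)
      = (A : ℂ) ^ (-(w / β)) * Gamma (w / β) / β := by
  have h := mellin_comp_rpow (fun t : ℝ => cexp (-(A * (t : ℂ)))) w β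
  simp only [mellin, smul_eq_mul] at h
  rw [integral_cpow_mul_cexp_Ioi (by rw [div_ofReal_re]; positivity) (by simpa using hA),
    abs_of_pos hβ, real_smul] at h
  push_cast at h ⊢
  rw [h]
  ring

/-- Up to the factor `e ^ (A lam ^ β)`, these are the negative moments of the stable law with
Laplace transform `p ↦ e ^ (-A p ^ β)`. -/
lemma IsTSPlus.integral_cpow_neg_expTilt {μ : Measure ℝ} {α β lam : ℝ} (h : IsTSPlus μ α β lam)
    (hα : 0 < α) (hβ : 0 < β) (hβ1 : β < 1) (hlam : 0 < lam) {w : ℂ} (hw : 0 < w.re) :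
    Integrable (fun x : ℝ => (x : ℂ) ^ (-w)) (expTilt μ lam) ∧
    ∫ x : ℝ, (x : ℂ) ^ (-w) ∂(expTilt μ lam) = (Real.exp (tsA α β * lam ^ β) : ℂ) *
      ((tsA α β : ℂ) ^ (-(w / β)) * Gamma (w / β) / β / Gamma w) := by
  have := h.isProb
  have hA := tsA_pos hα hβ hβ1
  have hLaplace (p : ℝ) (hp : p ∈ Ioi 0) := h.integral_exp_neg_expTilt hα hβ hβ1 hlam hp
  have hintOn : IntegrableOn
      (fun p => p ^ (w.re - 1) * ∫ x, Real.exp (-(p * x)) ∂(expTilt μ lam)) (Ioi 0) := by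
    have hpow := (integrableOn_rpow_mul_exp_neg_mul_rpow (s := w.re - 1) (by linarith) hβ hA)
    refine IntegrableOn.congr_fun (hpow.const_mul (Real.exp (tsA α β * lam ^ β))) (fun p hp => ?_)
      measurableSet_Ioi
    simp only [hLaplace p hp]
    ring_nf
  obtain ⟨hint, heq⟩ := integral_cpow_neg_mul_Gamma
    (ae_expTilt_of_ae (h.ae_pos hα hβ hβ1 hlam) lam) hw
    (fun p hp => h.integrable_exp_neg_expTilt hα hβ hβ1 hlam hp) hintOn
  refine ⟨hint, ?_⟩
  rw [eq_div_of_mul_eq (Gamma_ne_zero_of_re_pos hw) heq, ← mul_div_assoc,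
    ← integral_cpow_mul_exp_neg_rpow hA hβ hw, ← integral_const_mul]
  congr 1
  refine setIntegral_congr_fun measurableSet_Ioi fun p hp => ?_
  simp only [hLaplace p hp]
  push_cast
  ring

end TemperedStable

/-! ### Densities from Mellin transforms -/

section DistributionFunction

open Set Filter Topology

variable {ν : Measure ℝ}

lemma monotone_measureReal_Iic (hν : ∀ x, ν (Iic x) ≠ ⊤) : Monotone fun x => ν.real (Iic x) :=
  fun _ b hab => measureReal_mono (Iic_subset_Iic.2 hab) (hν b)

lemma tendsto_measureReal_Iic_nhdsGT (hν : ∀ x, ν (Iic x) ≠ ⊤) (x : ℝ) :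
    Tendsto (fun z => ν.real (Iic z)) (𝓝[>] x) (𝓝 (ν.real (Iic x))) := by
  have hInter : (⋂ r > x, Iic r) = Iic x := by
    ext y
    simp only [mem_iInter, mem_Iic]
    exact ⟨le_of_forall_gt_imp_ge_of_dense, fun h r hr => h.trans hr.le⟩
  have htend := tendsto_measure_biInter_gt (μ := ν) (s := Iic) (a := x)
    (fun r _ => measurableSet_Iic.nullMeasurableSet) (fun i j _ hij => Iic_subset_Iic.2 hij)
    ⟨x + 1, by simp, hν _⟩
  rw [hInter] at htend
  exact (ENNReal.tendsto_toReal (hν x)).comp htend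

lemma eq_withDensity_deriv_measureReal_Iic (hν : ∀ x, ν (Iic x) ≠ ⊤) {s : Set ℝ}
    (hs : s.Countable) (hcont : Continuous fun x => ν.real (Iic x))
    (hdiff : ∀ x ∉ s, DifferentiableAt ℝ (fun x => ν.real (Iic x)) x) :
    ν = volume.withDensity fun x => ENNReal.ofReal (deriv (fun x => ν.real (Iic x)) x) := by
  have hmono := monotone_measureReal_Iic hν
  have hIoc (a b : ℝ) : ν (Ioc a b) ≠ ⊤ := measure_ne_top_of_subset Ioc_subset_Iic_self (hν b)
  refine Measure.ext_of_Ioc' _ _ (fun a b _ => hIoc a b) fun a b hab => ?_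
  have hint : IntervalIntegrable (deriv fun x => ν.real (Iic x)) volume a b :=
    (hmono.monotoneOn _).intervalIntegrable_deriv
  have hFTC := integral_eq_of_hasDerivAt_off_countable_of_le _ _ hab.le hs hcont.continuousOn
    (fun x hx => (hdiff x hx.2).hasDerivAt) hint
  rw [intervalIntegral.integral_of_le hab.le] at hFTC
  rw [withDensity_apply _ measurableSet_Ioc, ← ofReal_integral_eq_lintegral_ofReal
    ((intervalIntegrable_iff_integrableOn_Ioc_of_le hab.le).1 hint)
    (.of_forall fun x => hmono.deriv_nonneg), hFTC,
    ← measureReal_sdiff (Iic_subset_Iic.2 hab.le) measurableSet_Iic (hν b), Iic_sdiff_Iic,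
    ofReal_measureReal (hIoc a b)]

lemma eq_of_forall_continuousAt_eq {f : ℝ → ℝ} (hf : Monotone f) {Φ : ℝ → ℂ} {x : ℝ}
    (hfx : Tendsto f (𝓝[>] x) (𝓝 (f x))) (hΦ : ContinuousAt Φ x)
    (h : ∀ z > x, ContinuousAt f z → (f z : ℂ) = Φ z) : (f x : ℂ) = Φ x := by
  have hfreq : ∃ᶠ z in 𝓝[>] x, (f z : ℂ) = Φ z := by
    rw [frequently_nhdsWithin_iff, frequently_iff]
    intro U hU
    obtain ⟨l, u, ⟨hlx, hxu⟩, hsub⟩ := mem_nhds_iff_exists_Ioo_subset.1 hU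
    obtain ⟨z, hcont, hz⟩ := (hf.countable_not_continuousAt.dense_compl ℝ).exists_mem_open
      isOpen_Ioo (nonempty_Ioo.2 hxu)
    exact ⟨z, hsub ⟨hlx.trans hz.1, hz.2⟩, h z hz.1 (not_not.1 hcont), hz.1⟩
  exact tendsto_nhds_unique_of_frequently_eq ((Complex.continuous_ofReal.tendsto _).comp hfx)
    (hΦ.tendsto.mono_left nhdsWithin_le_nhds) hfreq

end DistributionFunction

section MellinDensity

open Complex Set Filter Topology
open scoped Real

variable {ν : Measure ℝ} {c : ℝ} {s : ℂ}

/-- The Mellin transform `∫ y ^ s ν(dy)` of a measure `ν` on `(0, ∞)`. For a measure with density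
`f`, it is the value at `s + 1` of `mellin f`. -/
noncomputable def measureMellin (ν : Measure ℝ) (s : ℂ) : ℂ := ∫ y : ℝ, (y : ℂ) ^ s ∂ν

/-- The density `y ↦ (2 π)⁻¹ ∫ M(c + i t) y ^ (-(c + i t) - 1) dt` recovered from the values of the
Mellin transform `M` of the measure `ν` on the line `re s = c`. -/
noncomputable def mellinDensity (ν : Measure ℝ) (c y : ℝ) : ℂ :=
  1 / (2 * π) * ∫ t : ℝ, measureMellin ν (linePoint c t) * (y : ℂ) ^ (-linePoint c t - 1)

lemma measure_Iic_eq_zero_of_ae_pos (hpos : ∀ᵐ y ∂ν, 0 < y) {x : ℝ} (hx : x ≤ 0) :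
    ν (Iic x) = 0 :=
  measure_mono_null (fun _ hy => not_lt.2 (le_trans hy hx)) (ae_iff.1 hpos)

lemma measure_Iic_ne_top (hpos : ∀ᵐ y ∂ν, 0 < y) (hc : c ≤ 0)
    (hint : Integrable (fun y => y ^ c) ν) (x : ℝ) : ν (Iic x) ≠ ⊤ := by
  rcases le_or_gt x 0 with hx | hx
  · rw [measure_Iic_eq_zero_of_ae_pos hpos hx]
    exact ENNReal.zero_ne_top
  · refine ne_top_of_le_ne_top (hint.measure_norm_ge_lt_top (Real.rpow_pos_of_pos hx c)).ne
      (measure_mono_ae ?_)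
    filter_upwards [hpos] with y hy hyx
    exact (Real.rpow_le_rpow_of_nonpos hy hyx hc).trans (le_abs_self _)

lemma indicator_Iic_const_eq_indicator_Ici {E : Type*} [Zero E] (f : ℝ → E) (x y : ℝ) :
    (Iic x).indicator (fun _ => f x) y = (Ici y).indicator f x := by
  simp only [indicator, mem_Iic, mem_Ici]

lemma setIntegral_Ioi_indicator_Ici {E : Type*} [NormedAddCommGroup E] [NormedSpace ℝ E]
    (f : ℝ → E) {y : ℝ} (hy : 0 < y) :
    ∫ x in Ioi 0, (Ici y).indicator f x = ∫ x in Ioi y, f x := by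
  rw [setIntegral_indicator measurableSet_Ici, inter_eq_right.2 (Ici_subset_Ioi.2 hy),
    integral_Ici_eq_integral_Ioi]

lemma integrable_indicator_Iic_cpow [SFinite ν] (hpos : ∀ᵐ y ∂ν, 0 < y) (hs : s.re < 0)
    (hint : Integrable (fun y => y ^ s.re) ν) :
    Integrable (Function.uncurry fun x y : ℝ => (Iic x).indicator (fun _ => (x : ℂ) ^ (s - 1)) y)
      ((volume.restrict (Ioi 0)).prod ν) := by
  have hmeas : Measurable
      (Function.uncurry fun x y : ℝ => (Iic x).indicator (fun _ => (x : ℂ) ^ (s - 1)) y) :=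
    Measurable.ite (measurableSet_le measurable_snd measurable_fst) (by fun_prop) measurable_const
  have hnorm (x : ℝ) (hx : x ∈ Ioi 0) (y : ℝ) :
      ‖(Iic x).indicator (fun _ => (x : ℂ) ^ (s - 1)) y‖
        = (Ici y).indicator (fun x => x ^ (s.re - 1)) x := by
    rw [norm_indicator_eq_indicator_norm, norm_cpow_eq_rpow_re_of_pos hx, sub_re, one_re,
      indicator_Iic_const_eq_indicator_Ici fun x : ℝ => x ^ (s.re - 1)]
  refine (integrable_prod_iff' hmeas.aestronglyMeasurable).2 ⟨?_, ?_⟩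
  · filter_upwards [hpos] with y hy
    have hIci : IntegrableOn (fun x : ℝ => x ^ (s.re - 1)) (Ici y) := by
      rw [integrableOn_Ici_iff_integrableOn_Ioi]
      exact integrableOn_Ioi_rpow_of_lt (by linarith) hy
    refine ((integrable_indicator_iff measurableSet_Ici).2 hIci).restrict.mono'
      (hmeas.comp measurable_prodMk_right).aestronglyMeasurable ?_
    filter_upwards [ae_restrict_mem measurableSet_Ioi] with x hx using (hnorm x hx y).le
  · refine (hint.mul_const (-s.re)⁻¹).congr ?_
    filter_upwards [hpos] with y hy
    simp only [Function.uncurry]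
    rw [setIntegral_congr_fun measurableSet_Ioi fun x hx => hnorm x hx y,
      setIntegral_Ioi_indicator_Ici _ hy, integral_Ioi_rpow_of_lt (by linarith) hy, sub_add_cancel]
    ring

lemma integral_indicator_Iic_cpow (x : ℝ) :
    ∫ y, (Iic x).indicator (fun _ => (x : ℂ) ^ (s - 1)) y ∂ν
      = (x : ℂ) ^ (s - 1) • ((ν.real (Iic x) : ℝ) : ℂ) := by
  rw [integral_indicator_const _ measurableSet_Iic, real_smul, smul_eq_mul, mul_comm]

lemma mellinConvergent_measureReal_Iic [SFinite ν] (hpos : ∀ᵐ y ∂ν, 0 < y) (hs : s.re < 0)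
    (hint : Integrable (fun y => y ^ s.re) ν) :
    MellinConvergent (fun x => ((ν.real (Iic x) : ℝ) : ℂ)) s := by
  simpa only [MellinConvergent, IntegrableOn, Function.uncurry, integral_indicator_Iic_cpow] using
    (integrable_indicator_Iic_cpow hpos hs hint).integral_prod_left

lemma mellin_measureReal_Iic [SFinite ν] (hpos : ∀ᵐ y ∂ν, 0 < y) (hs : s.re < 0)
    (hint : Integrable (fun y => y ^ s.re) ν) :
    mellin (fun x => ((ν.real (Iic x) : ℝ) : ℂ)) s = measureMellin ν s * (-s)⁻¹ := by
  simp only [mellin, ← integral_indicator_Iic_cpow]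
  rw [integral_integral_swap (integrable_indicator_Iic_cpow hpos hs hint), measureMellin,
    ← integral_mul_const]
  refine integral_congr_ae ?_
  filter_upwards [hpos] with y hy
  simp only [indicator_Iic_const_eq_indicator_Ici fun x : ℝ => (x : ℂ) ^ (s - 1)]
  rw [setIntegral_Ioi_indicator_Ici _ hy, integral_Ioi_cpow_of_lt (by simp; linarith) hy,
    sub_add_cancel, neg_div, ← div_neg, div_eq_mul_inv]

lemma norm_inv_neg_linePoint_le (hc : c < 0) (t : ℝ) : ‖(-linePoint c t)⁻¹‖ ≤ (-c)⁻¹ := by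
  rw [norm_inv, norm_neg]
  refine inv_anti₀ (neg_pos.2 hc) ?_
  simpa [abs_of_neg hc] using abs_re_le_norm (linePoint c t)

lemma integrable_cpow_mul_measureMellin_mul_inv (hc : c < 0)
    (hM : Integrable fun t => measureMellin ν (linePoint c t)) {x : ℝ} (hx : 0 < x) :
    Integrable fun t => (x : ℂ) ^ (-linePoint c t)
      * (measureMellin ν (linePoint c t) * (-linePoint c t)⁻¹) := by
  have hinv : Integrable fun t => measureMellin ν (linePoint c t) * (-linePoint c t)⁻¹ :=
    hM.mul_bdd (Measurable.aestronglyMeasurable (by fun_prop))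
      (.of_forall (norm_inv_neg_linePoint_le hc))
  refine hinv.bdd_mul (c := x ^ (-c)) (Measurable.aestronglyMeasurable (by fun_prop))
    (.of_forall fun t => ?_)
  rw [neg_linePoint, norm_cpow_linePoint hx]

lemma rpow_le_add_rpow {a x b e : ℝ} (ha : 0 < a) (hax : a ≤ x) (hxb : x ≤ b) :
    x ^ e ≤ a ^ e + b ^ e := by
  have hx : 0 < x := ha.trans_le hax
  rcases le_total 0 e with he | he
  · exact (Real.rpow_le_rpow hx.le hxb he).trans (le_add_of_nonneg_left (Real.rpow_nonneg ha.le e))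
  · exact (Real.rpow_le_rpow_of_nonpos ha hax he).trans
      (le_add_of_nonneg_right (Real.rpow_nonneg (hx.trans_le hxb).le e))

lemma hasDerivAt_mellinDensity_primitive (hc : c < 0)
    (hM : Integrable fun t => measureMellin ν (linePoint c t)) {x : ℝ} (hx : 0 < x) :
    HasDerivAt (fun x : ℝ => 1 / (2 * π : ℂ) * ∫ t : ℝ, (x : ℂ) ^ (-linePoint c t)
      * (measureMellin ν (linePoint c t) * (-linePoint c t)⁻¹)) (mellinDensity ν c x) x := by
  have hpos {z : ℝ} (hz : z ∈ Ioo (x / 2) (2 * x)) : 0 < z := (half_pos hx).trans hz.1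
  refine HasDerivAt.const_mul _ (hasDerivAt_integral_of_dominated_loc_of_deriv_le
    (F' := fun (x t : ℝ) => measureMellin ν (linePoint c t) * (x : ℂ) ^ (-linePoint c t - 1))
    (bound := fun t => ‖measureMellin ν (linePoint c t)‖
      * ((x / 2) ^ (-c - 1) + (2 * x) ^ (-c - 1)))
    (Ioo_mem_nhds (half_lt_self hx) (by linarith : x < 2 * x)) ?_
    (integrable_cpow_mul_measureMellin_mul_inv hc hM hx)
    (hM.1.mul (Measurable.aestronglyMeasurable (by fun_prop))) ?_ (hM.norm.mul_const _) ?_).2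
  · filter_upwards [lt_mem_nhds hx] with z hz
    exact (integrable_cpow_mul_measureMellin_mul_inv hc hM hz).1
  · refine .of_forall fun t z hz => ?_
    rw [norm_mul, norm_cpow_eq_rpow_re_of_pos (hpos hz), sub_re, neg_re, linePoint_re, one_re]
    gcongr
    exact rpow_le_add_rpow (half_pos hx) hz.1.le hz.2.le
  · refine .of_forall fun t z hz => ?_
    have hne : linePoint c t ≠ 0 := fun h => hc.ne (by simpa using congrArg re h)
    refine ((hasDerivAt_ofReal_cpow_const (hpos hz).ne' (neg_ne_zero.2 hne)).mul_const
      _).congr_deriv ?_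
    field_simp

lemma measureReal_Iic_eq_mellinInv [SFinite ν] (hpos : ∀ᵐ y ∂ν, 0 < y) (hc : c < 0)
    (hint : Integrable (fun y => y ^ c) ν)
    (hM : Integrable fun t => measureMellin ν (linePoint c t)) {x : ℝ} (hx : 0 < x) :
    ((ν.real (Iic x) : ℝ) : ℂ) = 1 / (2 * π : ℂ) * ∫ t : ℝ, (x : ℂ) ^ (-linePoint c t)
      * (measureMellin ν (linePoint c t) * (-linePoint c t)⁻¹) := by
  have hfin := measure_Iic_ne_top hpos hc.le hint
  have hmellin (t : ℝ) : mellin (fun x => ((ν.real (Iic x) : ℝ) : ℂ)) (c + t * I)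
      = measureMellin ν (linePoint c t) * (-linePoint c t)⁻¹ :=
    mellin_measureReal_Iic (s := linePoint c t) hpos (by simpa using hc) (by simpa using hint)
  have hvert : VerticalIntegrable (mellin fun x => ((ν.real (Iic x) : ℝ) : ℂ)) c := by
    simpa only [VerticalIntegrable, hmellin, ofReal_one, one_cpow, one_mul] using
      integrable_cpow_mul_measureMellin_mul_inv hc hM one_pos
  refine eq_of_forall_continuousAt_eq (monotone_measureReal_Iic hfin)
    (tendsto_measureReal_Iic_nhdsGT hfin x)
    (hasDerivAt_mellinDensity_primitive hc hM hx).continuousAt fun z hz hcont => ?_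
  rw [← mellinInv_mellin_eq c (fun x => ((ν.real (Iic x) : ℝ) : ℂ)) (hx.trans hz)
    (mellinConvergent_measureReal_Iic hpos (by simpa using hc) (by simpa using hint)) hvert
    (continuous_ofReal.continuousAt.comp hcont), mellinInv]
  simp only [hmellin, smul_eq_mul, real_smul]
  push_cast
  rfl

lemma hasDerivAt_measureReal_Iic [SFinite ν] (hpos : ∀ᵐ y ∂ν, 0 < y) (hc : c < 0)
    (hint : Integrable (fun y => y ^ c) ν)
    (hM : Integrable fun t => measureMellin ν (linePoint c t)) {x : ℝ} (hx : 0 < x) :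
    HasDerivAt (fun x => ((ν.real (Iic x) : ℝ) : ℂ)) (mellinDensity ν c x) x := by
  refine (hasDerivAt_mellinDensity_primitive hc hM hx).congr_of_eventuallyEq ?_
  filter_upwards [lt_mem_nhds hx] with z hz
  exact measureReal_Iic_eq_mellinInv hpos hc hint hM hz

theorem exists_eq_withDensity_mellinDensity [SFinite ν] (hpos : ∀ᵐ y ∂ν, 0 < y) (hc : c < 0)
    (hint : Integrable (fun y => y ^ c) ν)
    (hM : Integrable fun t => measureMellin ν (linePoint c t)) :
    ∃ g : ℝ → ℝ, Measurable g ∧ (∀ y, 0 ≤ g y) ∧ (∀ y > 0, (g y : ℂ) = mellinDensity ν c y) ∧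
      ν = (volume.restrict (Ioi 0)).withDensity fun y => ENNReal.ofReal (g y) := by
  set F : ℝ → ℝ := fun x => ν.real (Iic x) with hF
  have hfin := measure_Iic_ne_top hpos hc.le hint
  have hderiv (y : ℝ) (hy : 0 < y) : HasDerivAt F (mellinDensity ν c y).re y :=
    reCLM.hasFDerivAt.comp_hasDerivAt y (hasDerivAt_measureReal_Iic hpos hc hint hM hy)
  have hzero (x : ℝ) (hx : x ≤ 0) : F x = 0 := by
    simp only [hF, measureReal_def, measure_Iic_eq_zero_of_ae_pos hpos hx, ENNReal.toReal_zero]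
  have hdiff (x : ℝ) (hx : x ≠ 0) : DifferentiableAt ℝ F x := by
    rcases lt_or_gt_of_ne hx with hx | hx
    · refine (differentiableAt_const (0 : ℝ)).congr_of_eventuallyEq ?_
      filter_upwards [gt_mem_nhds hx] with z hz using hzero z hz.le
    · exact (hderiv x hx).differentiableAt
  have hcont : Continuous F := by
    refine continuous_iff_continuousAt.2 fun x => ?_
    rcases eq_or_ne x 0 with rfl | hx
    · refine continuousAt_iff_continuous_left'_right'.2
        ⟨?_, tendsto_measureReal_Iic_nhdsGT hfin 0⟩
      exact continuousWithinAt_const.congr (fun z hz => hzero z (le_of_lt hz)) (hzero 0 le_rfl)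
    · exact (hdiff x hx).continuousAt
  refine ⟨deriv F, measurable_deriv F, fun y => (monotone_measureReal_Iic hfin).deriv_nonneg,
    fun y hy => ?_, ?_⟩
  · exact (hderiv y hy).differentiableAt.hasDerivAt.ofReal_comp.unique
      (hasDerivAt_measureReal_Iic hpos hc hint hM hy)
  · rw [← restrict_withDensity measurableSet_Ioi, ← eq_withDensity_deriv_measureReal_Iic hfin
      (countable_singleton 0) hcont hdiff, Measure.restrict_eq_self_of_ae_mem (s := Ioi 0) hpos]

end MellinDensity

/-! ### Separation of the contour variables -/

section ContourCoordinates

open Complex Set Filter Topology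

variable {n : ℕ} {βp βm lamSum b Ap Am κ c₁ cW cV c₄ : ℝ}

lemma mbIntegral_eq_div (c : Fin n → ℝ) (F : (Fin n → ℂ) → ℂ) :
    mbIntegral c F = (∫ y : Fin n → ℝ, F (contourPoint c y)) / (2 * Real.pi) ^ n := by
  rw [mbIntegral, integral_mul_const, mul_pow, mul_div_mul_right _ _ (pow_ne_zero _ I_ne_zero)]

/-- Coordinates `((s, w), (v, r))` on `ℝ⁴` in which the Mellin–Barnes integrand is almost a product:
`s` and `r` are the first and last variables of the integrand, and `v`, `w` are the arguments of
the first and third gamma functions of its numerator. -/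
noncomputable def contourCoord : ((ℝ × ℝ) × (ℝ × ℝ)) ≃ᵐ (Fin 4 → ℝ) where
  toFun p := ![p.1.1, -(p.2.1 + p.1.2), (p.1.1 + p.2.1 - p.1.2) / 2, p.2.2]
  invFun f := ((f 0, (f 0 - f 1) / 2 - f 2), (f 2 - (f 0 + f 1) / 2, f 3))
  left_inv p := by ext <;> simp <;> ring
  right_inv f := by
    ext i
    fin_cases i <;> simp <;> ring
  measurable_toFun := by
    simp only [Equiv.coe_fn_mk]
    fun_prop
  measurable_invFun := by
    simp only [Equiv.coe_fn_symm_mk]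
    fun_prop

lemma measurePreserving_vec4 :
    MeasurePreserving fun p : (ℝ × ℝ) × (ℝ × ℝ) =>
      (![p.1.1, p.1.2, p.2.1, p.2.2] : Fin 4 → ℝ) := by
  have hmeas : Measurable fun p : (ℝ × ℝ) × (ℝ × ℝ) =>
      (![p.1.1, p.1.2, p.2.1, p.2.2] : Fin 4 → ℝ) := by
    fun_prop
  refine ⟨hmeas, (Measure.pi_eq fun t ht => ?_).symm⟩
  have hpre : (fun p : (ℝ × ℝ) × (ℝ × ℝ) => (![p.1.1, p.1.2, p.2.1, p.2.2] : Fin 4 → ℝ)) ⁻¹'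
      univ.pi t = (t 0 ×ˢ t 1) ×ˢ (t 2 ×ˢ t 3) := by
    ext p
    simp [Set.mem_pi, Fin.forall_fin_succ, and_assoc]
  rw [Measure.map_apply hmeas (MeasurableSet.univ_pi ht), hpre, Measure.volume_eq_prod,
    Measure.prod_prod, Measure.volume_eq_prod, Measure.prod_prod, Measure.prod_prod,
    Fin.prod_univ_four]
  ring

lemma measurePreserving_contourCoord : MeasurePreserving contourCoord := by
  set M : Matrix (Fin 4) (Fin 4) ℝ :=
    !![1, 0, 0, 0; 0, -1, -1, 0; 1 / 2, -1 / 2, 1 / 2, 0; 0, 0, 0, 1] with hM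
  have hdet : M.det = -1 := by
    simp [hM, Matrix.det_succ_row_zero, Fin.sum_univ_succ, Fin.succAbove]
    norm_num
  have hlin : MeasurePreserving (Matrix.toLin' M) := by
    refine ⟨(LinearMap.continuous_of_finiteDimensional _).measurable, ?_⟩
    rw [Real.map_matrix_volume_pi_eq_smul_volume_pi (by rw [hdet]; norm_num), hdet]
    simp
  have hcomp : ⇑contourCoord = Matrix.toLin' M ∘ fun p : (ℝ × ℝ) × (ℝ × ℝ) =>
      (![p.1.1, p.1.2, p.2.1, p.2.2] : Fin 4 → ℝ) := by
    ext p i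
    fin_cases i <;>
      simp [contourCoord, hM, Matrix.toLin'_apply, Matrix.mulVec, dotProduct, Fin.sum_univ_succ]
    ring
  rw [hcomp]
  exact hlin.comp measurePreserving_vec4

lemma contourCoord_mem_admissible (hβp : 0 < βp)
    (h : contourCoord ((c₁, cW), (cV, c₄)) ∈ admissible βp βm) :
    c₁ < 0 ∧ 0 < cW ∧ cW < 1 + c₁ ∧ 0 < cV ∧ 0 < c₄ ∧ 0 < c₁ - cW + c₄ := by
  obtain ⟨hgamma, hsum⟩ := h
  have hargs : matU βp βm *ᵥ contourCoord ((c₁, cW), (cV, c₄)) + vecU =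
      ![cV, 1 + c₁ - cW, cW, -(c₁ / βp), (cV + cW) / βm, c₄] := by
    ext i
    fin_cases i <;> simp [contourCoord, matU, vecU] <;> ring
  have hdot : contourCoord ((c₁, cW), (cV, c₄)) ⬝ᵥ ![1 / 2, 1 / 2, 1, 1] = c₁ - cW + c₄ := by
    simp [contourCoord, dotProduct, Fin.sum_univ_succ]
    ring
  rw [hargs] at hgamma
  have hc₁ : 0 < -(c₁ / βp) := hgamma 3
  have hW1 : 0 < 1 + c₁ - cW := hgamma 1
  rw [← neg_div, div_pos_iff_of_pos_right hβp, neg_pos] at hc₁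
  exact ⟨hc₁, hgamma 2, sub_pos.1 hW1, hgamma 0, hgamma 5, hdot ▸ hsum⟩

lemma contourPoint_contourCoord (p : (ℝ × ℝ) × (ℝ × ℝ)) :
    contourPoint (contourCoord ((c₁, cW), (cV, c₄))) (contourCoord p) =
      ![linePoint c₁ p.1.1, -(linePoint cV p.2.1 + linePoint cW p.1.2),
        (linePoint c₁ p.1.1 + linePoint cV p.2.1 - linePoint cW p.1.2) / 2,
        linePoint c₄ p.2.2] := by
  ext i
  fin_cases i <;> simp [contourPoint, contourCoord, linePoint] <;> ring

/-- The Mellin–Barnes integrand in the coordinates `contourCoord`, the gamma quotients which belong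
to the laws of `Y` and `Z` being replaced by arbitrary functions `M` and `N`. -/
noncomputable def separatedIntegrand (M N : ℂ → ℂ) (a b κ c₁ cW cV c₄ : ℝ)
    (p : (ℝ × ℝ) × (ℝ × ℝ)) : ℂ :=
  coupledFactor M c₁ cW p.1 *
    ((Gamma (linePoint cV p.2.1) * (a : ℂ) ^ (-linePoint cV p.2.1)) *
      (Gamma (linePoint c₄ p.2.2) * (b : ℂ) ^ (-linePoint c₄ p.2.2))) *
    (N (-(linePoint cV p.2.1 + linePoint cW p.1.2)) *
      ((κ : ℂ) ^ (-(linePoint c₁ p.1.1 - linePoint cW p.1.2 + linePoint c₄ p.2.2)) /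
        (linePoint c₁ p.1.1 - linePoint cW p.1.2 + linePoint c₄ p.2.2)))

lemma callIntegrand_eq (s w v r : ℂ) :
    callIntegrand βp βm lamSum b Ap Am (-κ) ![s, -(v + w), (s + v - w) / 2, r] =
      stableMellin Ap βp s / Gamma (1 + s) * (Gamma w * Gamma (1 + s - w)) *
        ((Gamma v * (lamSum : ℂ) ^ (-v)) * (Gamma r * (b : ℂ) ^ (-r))) *
        (stableMellin Am βm (-(v + w)) * ((κ : ℂ) ^ (-(s - w + r)) / (s - w + r))) := by
  have hnum : (matU βp βm).map Complex.ofReal *ᵥ ![s, -(v + w), (s + v - w) / 2, r]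
      + (fun i => (vecU i : ℂ)) = ![v, 1 + s - w, w, -s / βp, (v + w) / βm, r] := by
    ext i
    fin_cases i <;>
      simp [matU, vecU, Matrix.mulVec, dotProduct, Fin.sum_univ_succ] <;> ring
  have hden : matD.map Complex.ofReal *ᵥ ![s, -(v + w)] + (fun i => (vecD i : ℂ))
      = ![1 + s, -s, v + w] := by
    ext i
    fin_cases i <;>
      simp [matD, vecD, Matrix.mulVec, dotProduct, Fin.sum_univ_succ]; ring
  have hsum : (s + -(v + w)) / 2 + (s + v - w) / 2 + r = s - w + r := by ring
  have hlamSum : (s + -(v + w)) / 2 - (s + v - w) / 2 = -v := by ring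
  have hmoneyness : -((s + -(v + w)) / 2) - (s + v - w) / 2 - r = -(s - w + r) := by ring
  have hneg : -(v + w) / (βm : ℂ) = -((v + w) / βm) := by ring
  simp only [callIntegrand, gammaQuot, Matrix.cons_val_zero, Matrix.cons_val_one, Matrix.cons_val]
  rw [hnum, hden, hsum, hlamSum, hmoneyness, Fin.prod_univ_six, Fin.prod_univ_three]
  simp only [Matrix.cons_val_zero, Matrix.cons_val_one, Matrix.cons_val, stableMellin, neg_neg,
    hneg, div_eq_mul_inv, mul_inv]
  ring

lemma callIntegrand_contourPoint_contourCoord (p : (ℝ × ℝ) × (ℝ × ℝ)) :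
    callIntegrand βp βm lamSum b Ap Am (-κ)
        (contourPoint (contourCoord ((c₁, cW), (cV, c₄))) (contourCoord p)) =
      separatedIntegrand (stableMellin Ap βp) (stableMellin Am βm) lamSum b κ c₁ cW cV c₄ p := by
  rw [contourPoint_contourCoord, callIntegrand_eq, separatedIntegrand, coupledFactor]

lemma mbIntegrable_callIntegrand_iff :
    MBIntegrable (contourCoord ((c₁, cW), (cV, c₄)))
        (callIntegrand βp βm lamSum b Ap Am (-κ)) ↔
      Integrable
        (separatedIntegrand (stableMellin Ap βp) (stableMellin Am βm) lamSum b κ c₁ cW cV c₄) := by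
  rw [MBIntegrable, ← measurePreserving_contourCoord.integrable_comp_emb
    contourCoord.measurableEmbedding]
  exact integrable_congr (.of_forall callIntegrand_contourPoint_contourCoord)

lemma mbIntegral_callIntegrand :
    mbIntegral (contourCoord ((c₁, cW), (cV, c₄))) (callIntegrand βp βm lamSum b Ap Am (-κ)) =
      (∫ p, separatedIntegrand (stableMellin Ap βp) (stableMellin Am βm) lamSum b κ c₁ cW cV c₄ p)
        / (2 * Real.pi) ^ 4 := by
  rw [mbIntegral_eq_div, ← measurePreserving_contourCoord.integral_comp
    contourCoord.measurableEmbedding]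
  simp only [callIntegrand_contourPoint_contourCoord]

end ContourCoordinates

section Fubini

open Complex Set Filter Topology

variable {νm νp : Measure ℝ} {M : ℂ → ℂ} {a b κ σ x z c₁ cW cV c₄ : ℝ}

/-- The kernel linking the contour variables `p = ((s, w), (v, r))` with the space variables
`q = (z, x)`. -/
noncomputable def mbKernel (c₁ cW cV c₄ : ℝ) (p : (ℝ × ℝ) × (ℝ × ℝ)) (q : ℝ × ℝ) : ℂ :=
  (q.1 : ℂ) ^ (-(linePoint cV p.2.1 + linePoint cW p.1.2)) *
    (q.2 : ℂ) ^ (-(linePoint c₁ p.1.1 - linePoint cW p.1.2 + linePoint c₄ p.2.2) - 1)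

/-- The part of `separatedIntegrand` which does not come from integrating `mbKernel` over space. -/
noncomputable def contourFactor (M : ℂ → ℂ) (a b c₁ cW cV c₄ : ℝ) (p : (ℝ × ℝ) × (ℝ × ℝ)) : ℂ :=
  coupledFactor M c₁ cW p.1 *
    ((Gamma (linePoint cV p.2.1) * (a : ℂ) ^ (-linePoint cV p.2.1)) *
      (Gamma (linePoint c₄ p.2.2) * (b : ℂ) ^ (-linePoint c₄ p.2.2)))

lemma integral_Gamma_mul_cpow_mul_cpow (hσ : 0 < σ) (ha : 0 < a) (hx : 0 < x) :
    ∫ y : ℝ, Gamma (linePoint σ y) * (a : ℂ) ^ (-linePoint σ y) * (x : ℂ) ^ (-linePoint σ y)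
      = 2 * Real.pi * Real.exp (-(a * x)) := by
  rw [← integral_Gamma_mul_cpow_neg hσ (mul_pos ha hx)]
  simp only [ofReal_mul, mul_cpow_ofReal_nonneg ha.le hx.le, mul_assoc]

lemma integrable_Gamma_mul_cpow (hσ : 0 < σ) (ha : 0 < a) :
    Integrable fun y => Gamma (linePoint σ y) * (a : ℂ) ^ (-linePoint σ y) := by
  refine (integrable_Gamma_linePoint hσ).mul_bdd (c := a ^ (-σ))
    (Measurable.aestronglyMeasurable (by fun_prop)) (.of_forall fun y => ?_)
  rw [neg_linePoint, norm_cpow_linePoint ha]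

lemma integrable_contourFactor (hV : 0 < cV) (h₄ : 0 < c₄) (ha : 0 < a) (hb : 0 < b)
    (hM : Integrable (coupledFactor M c₁ cW)) : Integrable (contourFactor M a b c₁ cW cV c₄) :=
  hM.mul_prod ((integrable_Gamma_mul_cpow hV ha).mul_prod (integrable_Gamma_mul_cpow h₄ hb))

lemma ae_prod_Ioi_pos (hpos : ∀ᵐ z ∂νm, 0 < z) (hκ : 0 < κ) :
    ∀ᵐ q : ℝ × ℝ ∂νm.prod (volume.restrict (Ioi κ)), 0 < q.1 ∧ 0 < q.2 := by
  have hfst : ∀ᵐ q : ℝ × ℝ ∂νm.prod (volume.restrict (Ioi κ)), 0 < q.1 :=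
    Measure.quasiMeasurePreserving_fst.ae hpos
  have hsnd : ∀ᵐ q : ℝ × ℝ ∂νm.prod (volume.restrict (Ioi κ)), q.2 ∈ Ioi κ :=
    Measure.quasiMeasurePreserving_snd.ae (ae_restrict_mem measurableSet_Ioi)
  filter_upwards [hfst, hsnd] with q hq₁ hq₂ using ⟨hq₁, hκ.trans hq₂⟩

lemma norm_mbKernel (hz : 0 < z) (hx : 0 < x) (p : (ℝ × ℝ) × (ℝ × ℝ)) :
    ‖mbKernel c₁ cW cV c₄ p (z, x)‖ = z ^ (-(cV + cW)) * x ^ (-(c₁ - cW + c₄) - 1) := by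
  rw [mbKernel, norm_mul, norm_cpow_eq_rpow_re_of_pos hz, norm_cpow_eq_rpow_re_of_pos hx]
  simp

lemma integrable_mul_mbKernel (hpos : ∀ᵐ z ∂νm, 0 < z) (hκ : 0 < κ)
    (hx : 0 < c₁ - cW + c₄) (hz : Integrable (fun z => z ^ (-(cV + cW))) νm)
    {F : (ℝ × ℝ) × (ℝ × ℝ) → ℂ} (hF : Integrable F) :
    Integrable (Function.uncurry fun p q => F p * mbKernel c₁ cW cV c₄ p q)
      (volume.prod (νm.prod (volume.restrict (Ioi κ)))) := by
  have hIoi : Integrable (fun x : ℝ => x ^ (-(c₁ - cW + c₄) - 1)) (volume.restrict (Ioi κ)) :=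
    integrableOn_Ioi_rpow_of_lt (by linarith) hκ
  have hmeas : Measurable (Function.uncurry (mbKernel c₁ cW cV c₄)) := by
    unfold mbKernel Function.uncurry
    fun_prop
  refine (hF.norm.mul_prod (hz.mul_prod hIoi)).mono'
    (hF.aestronglyMeasurable.comp_fst.mul hmeas.aestronglyMeasurable) ?_
  filter_upwards [Measure.quasiMeasurePreserving_snd.ae (ae_prod_Ioi_pos hpos hκ)] with ⟨p, q⟩ hq
  rw [Function.uncurry, norm_mul, norm_mbKernel hq.1 hq.2]

lemma integral_mbKernel_space [SFinite νm] (hκ : 0 < κ) (hx : 0 < c₁ - cW + c₄)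
    (p : (ℝ × ℝ) × (ℝ × ℝ)) :
    ∫ q, mbKernel c₁ cW cV c₄ p q ∂νm.prod (volume.restrict (Ioi κ)) =
      measureMellin νm (-(linePoint cV p.2.1 + linePoint cW p.1.2)) *
        ((κ : ℂ) ^ (-(linePoint c₁ p.1.1 - linePoint cW p.1.2 + linePoint c₄ p.2.2)) /
          (linePoint c₁ p.1.1 - linePoint cW p.1.2 + linePoint c₄ p.2.2)) := by
  set ρ : ℂ := linePoint c₁ p.1.1 - linePoint cW p.1.2 + linePoint c₄ p.2.2 with hρ
  have hre : (-ρ - 1).re < -1 := by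
    simp only [hρ, sub_re, neg_re, add_re, linePoint_re, one_re]
    linarith
  unfold mbKernel
  rw [integral_prod_mul (fun z : ℝ => (z : ℂ) ^ (-(linePoint cV p.2.1 + linePoint cW p.1.2)))
    (fun x : ℝ => (x : ℂ) ^ (-ρ - 1)), integral_Ioi_cpow_of_lt hre hκ, sub_add_cancel, div_neg,
    neg_div, neg_neg, measureMellin]

lemma integral_Gamma_mul_Gamma_mul_cpow_mul_cpow {ρ : ℂ} (hσ : 0 < σ) (hρ : σ < ρ.re)
    (hz : 0 < z) (hx : 0 < x) :
    ∫ w : ℝ, Gamma (linePoint σ w) * Gamma (ρ - linePoint σ w) *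
        ((z : ℂ) ^ (-linePoint σ w) * (x : ℂ) ^ (linePoint σ w - ρ)) =
      2 * Real.pi * (Gamma ρ * ((x + z : ℝ) : ℂ) ^ (-ρ)) := by
  have hxc : (x : ℂ) ≠ 0 := ofReal_ne_zero.2 hx.ne'
  have hhomogeneous (s : ℂ) : (z : ℂ) ^ (-s) * (x : ℂ) ^ (s - ρ)
      = ((z / x : ℝ) : ℂ) ^ (-s) * (x : ℂ) ^ (-ρ) := by
    rw [sub_eq_add_neg, cpow_add _ _ hxc, ← mul_assoc]
    nth_rewrite 1 [← div_mul_cancel₀ z hx.ne']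
    rw [ofReal_mul, mul_cpow_ofReal_nonneg (by positivity) hx.le, mul_assoc (_ ^ _),
      ← cpow_add _ _ hxc, neg_add_cancel, cpow_zero, mul_one]
  simp only [hhomogeneous, ← mul_assoc]
  rw [integral_mul_const, integral_Gamma_mul_Gamma_mul_cpow_neg hσ hρ (div_pos hz hx),
    mul_assoc (2 * _ : ℂ), mul_assoc (Gamma ρ), ← mul_cpow_ofReal_nonneg (by positivity) hx.le,
    ← ofReal_mul, add_mul, div_mul_cancel₀ _ hx.ne', one_mul, ← mul_assoc]

lemma integral_coupledFactor (hW : 0 < cW) (hW1 : cW < 1 + c₁) (hz : 0 < z) (hx : 0 < x)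
    (hM : Integrable (coupledFactor M c₁ cW)) :
    ∫ p : ℝ × ℝ, coupledFactor M c₁ cW p * ((z : ℂ) ^ (-linePoint cW p.2) *
        (x : ℂ) ^ (-(linePoint c₁ p.1 - linePoint cW p.2) - 1)) =
      2 * Real.pi * ∫ s : ℝ, M (linePoint c₁ s) * ((x + z : ℝ) : ℂ) ^ (-linePoint c₁ s - 1) := by
  have hint : Integrable fun p : ℝ × ℝ => coupledFactor M c₁ cW p *
      ((z : ℂ) ^ (-linePoint cW p.2) *
        (x : ℂ) ^ (-(linePoint c₁ p.1 - linePoint cW p.2) - 1)) := by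
    refine hM.mul_bdd (c := z ^ (-cW) * x ^ (-(c₁ - cW) - 1))
      (Measurable.aestronglyMeasurable (by fun_prop)) (.of_forall fun p => ?_)
    rw [norm_mul, norm_cpow_eq_rpow_re_of_pos hz, norm_cpow_eq_rpow_re_of_pos hx]
    simp
  rw [Measure.volume_eq_prod, integral_prod _ hint, ← integral_const_mul]
  refine integral_congr_ae (.of_forall fun s => ?_)
  have hre : cW < (1 + linePoint c₁ s).re := by simpa using hW1
  have hGamma : Gamma (1 + linePoint c₁ s) ≠ 0 := Gamma_ne_zero_of_re_pos (hW.trans hre)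
  have hexp (w : ℝ) : -(linePoint c₁ s - linePoint cW w) - 1
      = linePoint cW w - (1 + linePoint c₁ s) := by ring
  simp only [coupledFactor, hexp]
  simp only [mul_assoc (M _ / _)]
  rw [integral_const_mul, integral_Gamma_mul_Gamma_mul_cpow_mul_cpow hW hre hz hx,
    neg_add_rev, ← sub_eq_add_neg]
  field_simp

lemma integral_contourFactor_mul_mbKernel (hW : 0 < cW) (hW1 : cW < 1 + c₁) (hV : 0 < cV)
    (h₄ : 0 < c₄) (ha : 0 < a) (hb : 0 < b) (hz : 0 < z) (hx : 0 < x)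
    (hM : Integrable (coupledFactor (measureMellin νp) c₁ cW)) :
    ∫ p, contourFactor (measureMellin νp) a b c₁ cW cV c₄ p * mbKernel c₁ cW cV c₄ p (z, x) =
      (2 * Real.pi) ^ 4 * (mellinDensity νp c₁ (x + z) *
        (Real.exp (-(a * z)) * Real.exp (-(b * x)))) := by
  have hzc : (z : ℂ) ≠ 0 := ofReal_ne_zero.2 hz.ne'
  have hxc : (x : ℂ) ≠ 0 := ofReal_ne_zero.2 hx.ne'
  have hseparate (p : (ℝ × ℝ) × (ℝ × ℝ)) :
      contourFactor (measureMellin νp) a b c₁ cW cV c₄ p * mbKernel c₁ cW cV c₄ p (z, x) =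
        (coupledFactor (measureMellin νp) c₁ cW p.1 * ((z : ℂ) ^ (-linePoint cW p.1.2) *
          (x : ℂ) ^ (-(linePoint c₁ p.1.1 - linePoint cW p.1.2) - 1))) *
        ((Gamma (linePoint cV p.2.1) * (a : ℂ) ^ (-linePoint cV p.2.1) *
            (z : ℂ) ^ (-linePoint cV p.2.1)) *
          (Gamma (linePoint c₄ p.2.2) * (b : ℂ) ^ (-linePoint c₄ p.2.2) *
            (x : ℂ) ^ (-linePoint c₄ p.2.2))) := by
    have hsplit : -(linePoint c₁ p.1.1 - linePoint cW p.1.2 + linePoint c₄ p.2.2) - 1 =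
        (-(linePoint c₁ p.1.1 - linePoint cW p.1.2) - 1) + -linePoint c₄ p.2.2 := by ring
    rw [contourFactor, mbKernel, hsplit, neg_add, cpow_add _ _ hzc, cpow_add _ _ hxc]
    ring
  have hpi : (Real.pi : ℂ) ≠ 0 := ofReal_ne_zero.2 Real.pi_ne_zero
  simp only [hseparate]
  rw [Measure.volume_eq_prod, integral_prod_mul (fun p : ℝ × ℝ =>
      coupledFactor (measureMellin νp) c₁ cW p * ((z : ℂ) ^ (-linePoint cW p.2) *
        (x : ℂ) ^ (-(linePoint c₁ p.1 - linePoint cW p.2) - 1))) (fun p : ℝ × ℝ =>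
      (Gamma (linePoint cV p.1) * (a : ℂ) ^ (-linePoint cV p.1) * (z : ℂ) ^ (-linePoint cV p.1)) *
        (Gamma (linePoint c₄ p.2) * (b : ℂ) ^ (-linePoint c₄ p.2) *
          (x : ℂ) ^ (-linePoint c₄ p.2))),
    integral_coupledFactor hW hW1 hz hx hM, Measure.volume_eq_prod, integral_prod_mul (fun v =>
      Gamma (linePoint cV v) * (a : ℂ) ^ (-linePoint cV v) * (z : ℂ) ^ (-linePoint cV v)) (fun r =>
      Gamma (linePoint c₄ r) * (b : ℂ) ^ (-linePoint c₄ r) * (x : ℂ) ^ (-linePoint c₄ r)),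
    integral_Gamma_mul_cpow_mul_cpow hV ha hz, integral_Gamma_mul_cpow_mul_cpow h₄ hb hx,
    mellinDensity]
  field_simp

lemma ae_integral_contourFactor_mul_mbKernel (hpos : ∀ᵐ z ∂νm, 0 < z) (hκ : 0 < κ) (hW : 0 < cW)
    (hW1 : cW < 1 + c₁) (hV : 0 < cV) (h₄ : 0 < c₄) (ha : 0 < a) (hb : 0 < b)
    (hM : Integrable (coupledFactor (measureMellin νp) c₁ cW)) :
    ∀ᵐ q ∂νm.prod (volume.restrict (Ioi κ)),
      ∫ p, contourFactor (measureMellin νp) a b c₁ cW cV c₄ p * mbKernel c₁ cW cV c₄ p q =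
        (2 * Real.pi) ^ 4 * (mellinDensity νp c₁ (q.2 + q.1) *
          (Real.exp (-(a * q.1)) * Real.exp (-(b * q.2)))) := by
  filter_upwards [ae_prod_Ioi_pos hpos hκ] with q hq using
    integral_contourFactor_mul_mbKernel hW hW1 hV h₄ ha hb hq.1 hq.2 hM

section Representation

variable [SFinite νm]

lemma integral_space_contourFactor_mul_mbKernel (hκ : 0 < κ) (hx : 0 < c₁ - cW + c₄)
    (p : (ℝ × ℝ) × (ℝ × ℝ)) :
    ∫ q, contourFactor M a b c₁ cW cV c₄ p * mbKernel c₁ cW cV c₄ p q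
        ∂νm.prod (volume.restrict (Ioi κ)) =
      separatedIntegrand M (measureMellin νm) a b κ c₁ cW cV c₄ p := by
  rw [integral_const_mul, integral_mbKernel_space hκ hx, contourFactor, separatedIntegrand]

theorem integrable_separatedIntegrand (hpos : ∀ᵐ z ∂νm, 0 < z) (hκ : 0 < κ)
    (hx : 0 < c₁ - cW + c₄) (hV : 0 < cV) (h₄ : 0 < c₄) (ha : 0 < a) (hb : 0 < b)
    (hz : Integrable (fun z => z ^ (-(cV + cW))) νm) (hM : Integrable (coupledFactor M c₁ cW)) :
    Integrable (separatedIntegrand M (measureMellin νm) a b κ c₁ cW cV c₄) :=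
  (integrable_mul_mbKernel (κ := κ) hpos hκ hx hz
    (integrable_contourFactor hV h₄ ha hb hM)).integral_prod_left.congr
      (.of_forall (integral_space_contourFactor_mul_mbKernel hκ hx))

theorem integrable_mellinDensity_add_mul_exp (hpos : ∀ᵐ z ∂νm, 0 < z) (hκ : 0 < κ)
    (hx : 0 < c₁ - cW + c₄) (hW : 0 < cW) (hW1 : cW < 1 + c₁) (hV : 0 < cV) (h₄ : 0 < c₄)
    (ha : 0 < a) (hb : 0 < b) (hz : Integrable (fun z => z ^ (-(cV + cW))) νm)
    (hM : Integrable (coupledFactor (measureMellin νp) c₁ cW)) :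
    Integrable (fun q : ℝ × ℝ => mellinDensity νp c₁ (q.2 + q.1) *
      (Real.exp (-(a * q.1)) * Real.exp (-(b * q.2)) : ℂ))
      (νm.prod (volume.restrict (Ioi κ))) := by
  have hpi : ((2 * Real.pi) ^ 4 : ℂ) ≠ 0 := by simp [Real.pi_ne_zero]
  have hint := (integrable_mul_mbKernel (κ := κ) hpos hκ hx hz
    (integrable_contourFactor hV h₄ ha hb hM)).integral_prod_right
  exact (integrable_const_mul_iff hpi.isUnit _).1
    (hint.congr (ae_integral_contourFactor_mul_mbKernel hpos hκ hW hW1 hV h₄ ha hb hM))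

theorem integral_separatedIntegrand (hpos : ∀ᵐ z ∂νm, 0 < z) (hκ : 0 < κ)
    (hx : 0 < c₁ - cW + c₄) (hW : 0 < cW) (hW1 : cW < 1 + c₁) (hV : 0 < cV) (h₄ : 0 < c₄)
    (ha : 0 < a) (hb : 0 < b) (hz : Integrable (fun z => z ^ (-(cV + cW))) νm)
    (hM : Integrable (coupledFactor (measureMellin νp) c₁ cW)) :
    ∫ p, separatedIntegrand (measureMellin νp) (measureMellin νm) a b κ c₁ cW cV c₄ p =
      (2 * Real.pi) ^ 4 * ∫ q : ℝ × ℝ, mellinDensity νp c₁ (q.2 + q.1) *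
        (Real.exp (-(a * q.1)) * Real.exp (-(b * q.2)))
        ∂νm.prod (volume.restrict (Ioi κ)) := by
  simp only [← integral_space_contourFactor_mul_mbKernel hκ hx]
  rw [integral_integral_swap (integrable_mul_mbKernel hpos hκ hx hz
    (integrable_contourFactor hV h₄ ha hb hM)), integral_congr_ae
    (ae_integral_contourFactor_mul_mbKernel hpos hκ hW hW1 hV h₄ ha hb hM), integral_const_mul]

end Representation

end Fubini

/-! ### Truncated exponential moments -/

section TruncExp

open Set

/-- The truncated exponential `e ^ (p x) 1_{x > κ}`: the power payoff as a function of the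
log-price. -/
noncomputable def truncExp (κ p x : ℝ) : ℝ := (Ioi κ).indicator (fun x => Real.exp (p * x)) x

variable {κ p x z : ℝ}

@[fun_prop]
lemma measurable_truncExp : Measurable (truncExp κ p) :=
  Measurable.indicator (by fun_prop) measurableSet_Ioi

lemma truncExp_of_lt (hx : κ < x) : truncExp κ p x = Real.exp (p * x) := indicator_of_mem hx _

lemma truncExp_of_le (hx : x ≤ κ) : truncExp κ p x = 0 := indicator_of_notMem hx.not_gt _

lemma exp_mul_truncExp (s : ℝ) : Real.exp (s * x) * truncExp κ p x = truncExp κ (s + p) x := by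
  rcases lt_or_ge κ x with hx | hx
  · rw [truncExp_of_lt hx, truncExp_of_lt hx, ← Real.exp_add, add_mul]
  · rw [truncExp_of_le hx, truncExp_of_le hx, mul_zero]

lemma norm_truncExp_sub_le (hκ : 0 ≤ κ) (hz : 0 ≤ z) :
    ‖truncExp κ p (x - z)‖ ≤ Real.exp (max p 0 * x) := by
  rcases lt_or_ge κ (x - z) with hx | hx
  · rw [truncExp_of_lt hx, Real.norm_of_nonneg (Real.exp_pos _).le, Real.exp_le_exp]
    calc p * (x - z) ≤ max p 0 * (x - z) :=
          mul_le_mul_of_nonneg_right (le_max_left p 0) (hκ.trans hx.le)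
      _ ≤ max p 0 * x := mul_le_mul_of_nonneg_left (sub_le_self x hz) (le_max_right p 0)
  · rw [truncExp_of_le hx, norm_zero]
    exact (Real.exp_pos _).le

lemma integral_truncExp_sub_expTilt (μ : Measure ℝ) (lam b κ z : ℝ) :
    ∫ y, truncExp κ (-b) (y - z) ∂(expTilt μ lam) =
      Real.exp (lam * z) * ∫ y, truncExp κ (lam - b) (y - z) ∂μ := by
  rw [integral_expTilt, ← integral_const_mul]
  refine integral_congr_ae (.of_forall fun y => ?_)
  simp only [smul_eq_mul]
  rw [sub_eq_add_neg lam, ← exp_mul_truncExp, ← mul_assoc, ← Real.exp_add, ← mul_add,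
    add_sub_cancel]

lemma integral_truncExp_sub_withDensity {g : ℝ → ℝ} (hg : Measurable g) (hg0 : ∀ y, 0 ≤ g y)
    (b : ℝ) (hκ : 0 ≤ κ) (hz : 0 ≤ z) :
    ∫ y, truncExp κ (-b) (y - z)
        ∂(volume.restrict (Ioi 0)).withDensity (fun y => ENNReal.ofReal (g y)) =
      ∫ x in Ioi κ, g (x + z) * Real.exp (-(b * x)) := by
  rw [integral_withDensity_eq_integral_toReal_smul (by fun_prop) (by simp)]
  simp only [ENNReal.toReal_ofReal (hg0 _), smul_eq_mul]
  have hvanish (y : ℝ) (hy : y ∉ Ioi 0) : g y * truncExp κ (-b) (y - z) = 0 := by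
    rw [truncExp_of_le (by linarith [notMem_Ioi.1 hy]), mul_zero]
  rw [setIntegral_eq_integral_of_forall_compl_eq_zero hvanish, ← integral_add_right_eq_self _ z,
    ← integral_indicator measurableSet_Ioi]
  refine integral_congr_ae (.of_forall fun x => ?_)
  simp only [add_sub_cancel_right, truncExp, indicator_apply, mul_ite, mul_zero, neg_mul]

end TruncExp

section TruncatedMoments

open Complex Set

lemma conv_map_neg {G : Type*} [AddGroup G] [MeasurableSpace G] [MeasurableAdd₂ G]
    [MeasurableNeg G] (μ ν : Measure G) [SFinite μ] [SFinite ν] :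
    μ.conv (ν.map fun x => -x) = (μ.prod ν).map fun p => p.1 - p.2 := by
  have hprod : μ.prod (ν.map fun x => -x) = (μ.prod ν).map (Prod.map id fun x => -x) := by
    rw [← Measure.map_prod_map _ _ measurable_id measurable_neg, Measure.map_id]
  rw [Measure.conv, hprod, Measure.map_map (by fun_prop) (by fun_prop)]
  simp only [Function.comp_def, Prod.map_fst, Prod.map_snd, id_eq, sub_eq_add_neg]

namespace IsTSPlus

variable {μ : Measure ℝ} {α β lam c σ : ℝ}

lemma measureMellin_expTilt (h : IsTSPlus μ α β lam) (hα : 0 < α) (hβ : 0 < β) (hβ1 : β < 1)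
    (hlam : 0 < lam) {s : ℂ} (hs : s.re < 0) :
    measureMellin (expTilt μ lam) s =
      (Real.exp (tsA α β * lam ^ β) / β : ℂ) * stableMellin (tsA α β) β s := by
  have hmoment := (h.integral_cpow_neg_expTilt hα hβ hβ1 hlam (w := -s) (by simpa using hs)).2
  rw [neg_neg] at hmoment
  rw [measureMellin, hmoment, stableMellin, neg_div, neg_neg]
  ring

lemma integrable_rpow_expTilt (h : IsTSPlus μ α β lam) (hα : 0 < α) (hβ : 0 < β) (hβ1 : β < 1)
    (hlam : 0 < lam) (hc : c < 0) : Integrable (fun x => x ^ c) (expTilt μ lam) := by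
  have hint := (h.integral_cpow_neg_expTilt hα hβ hβ1 hlam (w := -(c : ℂ)) (by simpa using hc)).1
  refine hint.re.congr ?_
  filter_upwards [ae_expTilt_of_ae h.ae_nonneg lam] with x hx
  rw [neg_neg, ← ofReal_cpow hx, RCLike.re_to_complex, ofReal_re]

lemma integrable_measureMellin_expTilt_linePoint (h : IsTSPlus μ α β lam) (hα : 0 < α)
    (hβ : 0 < β) (hβ1 : β < 1) (hlam : 0 < lam) (hc : c < 0) (hc1 : -1 < c) :
    Integrable fun y => measureMellin (expTilt μ lam) (linePoint c y) := by
  have hline (y : ℝ) : (linePoint c y).re < 0 := by simpa using hc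
  simp only [h.measureMellin_expTilt hα hβ hβ1 hlam (hline _)]
  exact (integrable_stableMellin_linePoint (tsA_pos hα hβ hβ1) hβ hβ1 hc hc1).const_mul _

lemma coupledFactor_measureMellin_expTilt (h : IsTSPlus μ α β lam) (hα : 0 < α) (hβ : 0 < β)
    (hβ1 : β < 1) (hlam : 0 < lam) (hc : c < 0) (p : ℝ × ℝ) :
    coupledFactor (measureMellin (expTilt μ lam)) c σ p =
      (Real.exp (tsA α β * lam ^ β) / β : ℂ) * coupledFactor (stableMellin (tsA α β) β) c σ p := by
  rw [coupledFactor, coupledFactor,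
    h.measureMellin_expTilt hα hβ hβ1 hlam (by simpa using hc)]
  ring

lemma integrable_coupledFactor_measureMellin_expTilt (h : IsTSPlus μ α β lam) (hα : 0 < α)
    (hβ : 0 < β) (hβ1 : β < 1) (hlam : 0 < lam) (hc : c < 0) (hσ : 0 < σ) (hσc : σ < 1 + c) :
    Integrable (coupledFactor (measureMellin (expTilt μ lam)) c σ) :=
  ((integrable_coupledFactor_stableMellin (tsA_pos hα hβ hβ1) hβ hβ1 hc hσ hσc).const_mul _).congr
    (.of_forall fun p => (h.coupledFactor_measureMellin_expTilt hα hβ hβ1 hlam hc p).symm)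

end IsTSPlus

variable {μp μm : Measure ℝ} {αp βp lamp αm βm lamm a b κ p c₁ cW cV c₄ : ℝ}

lemma separatedIntegrand_measureMellin_expTilt (hp : IsTSPlus μp αp βp lamp)
    (hm : IsTSPlus μm αm βm lamm) (hαp : 0 < αp) (hβp : 0 < βp) (hβp1 : βp < 1)
    (hlamp : 0 < lamp) (hαm : 0 < αm) (hβm : 0 < βm) (hβm1 : βm < 1) (hlamm : 0 < lamm)
    (hc₁ : c₁ < 0) (hVW : 0 < cV + cW) (q : (ℝ × ℝ) × (ℝ × ℝ)) :
    separatedIntegrand (measureMellin (expTilt μp lamp)) (measureMellin (expTilt μm lamm))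
        a b κ c₁ cW cV c₄ q =
      (Real.exp (tsA αp βp * lamp ^ βp + tsA αm βm * lamm ^ βm) / (βp * βm) : ℝ) *
        separatedIntegrand (stableMellin (tsA αp βp) βp) (stableMellin (tsA αm βm) βm)
          a b κ c₁ cW cV c₄ q := by
  have hre : (-(linePoint cV q.2.1 + linePoint cW q.1.2)).re < 0 := by
    rw [neg_re, add_re, linePoint_re, linePoint_re]
    linarith
  rw [separatedIntegrand, separatedIntegrand,
    hp.coupledFactor_measureMellin_expTilt hαp hβp hβp1 hlamp hc₁,
    hm.measureMellin_expTilt hαm hβm hβm1 hlamm hre, Real.exp_add]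
  push_cast
  ring

lemma integrable_truncExp_sub (hp : IsTSPlus μp αp βp lamp) (hm : IsTSPlus μm αm βm lamm)
    (hαp : 0 < αp) (hβp : 0 < βp) (hβp1 : βp < 1) (hlamp : 0 < lamp) (hplam : p < lamp)
    (hκ : 0 ≤ κ) : Integrable (fun q : ℝ × ℝ => truncExp κ p (q.1 - q.2)) (μp.prod μm) := by
  have := hp.isProb
  have := hm.isProb
  have hdom : Integrable (fun q : ℝ × ℝ => Real.exp (max p 0 * q.1)) (μp.prod μm) :=
    (hp.integrable_exp_mul hαp hβp hβp1 hlamp (max_lt hplam hlamp)).comp_fst μm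
  refine hdom.mono' (Measurable.aestronglyMeasurable (by fun_prop)) ?_
  filter_upwards [Measure.quasiMeasurePreserving_snd.ae hm.ae_nonneg] with q hq using
    norm_truncExp_sub_le hκ hq

lemma integral_mellinDensity_add_mul_exp (hp : IsTSPlus μp αp βp lamp) (hαp : 0 < αp)
    (hβp : 0 < βp) (hβp1 : βp < 1) (hlamp : 0 < lamp) (hc₁ : c₁ < 0) (hc₁1 : -1 < c₁)
    (hκ : 0 ≤ κ) {z : ℝ} (hz : 0 ≤ z) :
    ∫ x in Ioi κ, mellinDensity (expTilt μp lamp) c₁ (x + z) * Real.exp (-(b * x)) =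
      (Real.exp (lamp * z) * ∫ y, truncExp κ (lamp - b) (y - z) ∂μp : ℝ) := by
  have := hp.isProb
  obtain ⟨g, hgmeas, hg0, hgeq, hgdens⟩ := exists_eq_withDensity_mellinDensity
    (ae_expTilt_of_ae (hp.ae_pos hαp hβp hβp1 hlamp) lamp) hc₁
    (hp.integrable_rpow_expTilt hαp hβp hβp1 hlamp hc₁)
    (hp.integrable_measureMellin_expTilt_linePoint hαp hβp hβp1 hlamp hc₁ hc₁1)
  have hshift := integral_truncExp_sub_withDensity hgmeas hg0 b hκ hz
  rw [← hgdens, integral_truncExp_sub_expTilt] at hshift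
  rw [hshift, ← integral_complex_ofReal]
  refine setIntegral_congr_fun measurableSet_Ioi fun x hx => ?_
  rw [ofReal_mul, hgeq (x + z) (add_pos_of_pos_of_nonneg (hκ.trans_lt hx) hz)]

lemma integral_separatedIntegrand_expTilt (hp : IsTSPlus μp αp βp lamp)
    (hm : IsTSPlus μm αm βm lamm) (hαp : 0 < αp) (hβp : 0 < βp) (hβp1 : βp < 1)
    (hlamp : 0 < lamp) (hαm : 0 < αm) (hβm : 0 < βm) (hβm1 : βm < 1) (hlamm : 0 < lamm)
    (hplam : p < lamp) (hκ : 0 < κ) (hc : contourCoord ((c₁, cW), (cV, c₄)) ∈ admissible βp βm) :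
    ∫ q, separatedIntegrand (measureMellin (expTilt μp lamp)) (measureMellin (expTilt μm lamm))
        (lamp + lamm) (lamp - p) κ c₁ cW cV c₄ q =
      (2 * Real.pi) ^ 4 * (∫ q : ℝ × ℝ, truncExp κ p (q.1 - q.2) ∂(μp.prod μm) : ℝ) := by
  have := hp.isProb
  have := hm.isProb
  obtain ⟨hc₁, hW, hW1, hV, h₄, hx⟩ := contourCoord_mem_admissible hβp hc
  have hpos := ae_expTilt_of_ae (hm.ae_pos hαm hβm hβm1 hlamm) lamm
  have hz := hm.integrable_rpow_expTilt hαm hβm hβm1 hlamm (c := -(cV + cW)) (by linarith)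
  have hM := hp.integrable_coupledFactor_measureMellin_expTilt hαp hβp hβp1 hlamp hc₁ hW hW1
  have ha : 0 < lamp + lamm := add_pos hlamp hlamm
  have hb : 0 < lamp - p := sub_pos.2 hplam
  rw [integral_separatedIntegrand hpos hκ hx hW hW1 hV h₄ ha hb hz hM, integral_prod _
    (integrable_mellinDensity_add_mul_exp hpos hκ hx hW hW1 hV h₄ ha hb hz hM), integral_expTilt,
    integral_prod_symm _ (integrable_truncExp_sub hp hm hαp hβp hβp1 hlamp hplam hκ.le),
    ← integral_complex_ofReal]
  congr 1
  refine integral_congr_ae ?_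
  filter_upwards [hm.ae_nonneg] with z hz0
  have hfactor : ∫ x in Ioi κ, mellinDensity (expTilt μp lamp) c₁ (x + z) *
        (Real.exp (-((lamp + lamm) * z)) * Real.exp (-((lamp - p) * x))) =
      Real.exp (-((lamp + lamm) * z)) * ∫ x in Ioi κ,
        mellinDensity (expTilt μp lamp) c₁ (x + z) * Real.exp (-((lamp - p) * x)) := by
    rw [← integral_const_mul]
    exact integral_congr_ae (.of_forall fun x => mul_left_comm _ _ _)
  have htilts :
      Real.exp (lamm * z) * Real.exp (-((lamp + lamm) * z)) * Real.exp (lamp * z) = 1 := by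
    rw [← Real.exp_add, ← Real.exp_add, Real.exp_eq_one_iff]
    ring
  rw [hfactor, integral_mellinDensity_add_mul_exp hp hαp hβp hβp1 hlamp hc₁ (by linarith) hκ.le
    hz0, sub_sub_cancel, real_smul, ← ofReal_mul, ← ofReal_mul, ← mul_assoc _ (Real.exp _),
    ← mul_assoc, htilts, one_mul]

namespace IsTS

variable {μ : Measure ℝ} {c : Fin 4 → ℝ}

lemma integrable_truncExp (h : IsTS μ αp βp lamp αm βm lamm) (hαp : 0 < αp) (hβp : 0 < βp)
    (hβp1 : βp < 1) (hlamp : 0 < lamp) (hplam : p < lamp) (hκ : 0 ≤ κ) :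
    Integrable (truncExp κ p) μ := by
  obtain ⟨μp, μm, hp, hm, rfl⟩ := h
  have := hp.isProb
  have := hm.isProb
  rw [conv_map_neg, integrable_map_measure measurable_truncExp.aestronglyMeasurable (by fun_prop)]
  exact integrable_truncExp_sub hp hm hαp hβp hβp1 hlamp hplam hκ

theorem mbIntegrable_callIntegrand (h : IsTS μ αp βp lamp αm βm lamm) (hαp : 0 < αp)
    (hβp : 0 < βp) (hβp1 : βp < 1) (hlamp : 0 < lamp) (hαm : 0 < αm) (hβm : 0 < βm)
    (hβm1 : βm < 1) (hlamm : 0 < lamm) (hplam : p < lamp) (hκ : 0 < κ)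
    (hc : c ∈ admissible βp βm) :
    MBIntegrable c (callIntegrand βp βm (lamp + lamm) (lamp - p) (tsA αp βp) (tsA αm βm) (-κ)) := by
  obtain ⟨μp, μm, hp, hm, -⟩ := h
  have := hm.isProb
  obtain ⟨⟨⟨c₁, cW⟩, ⟨cV, c₄⟩⟩, rfl⟩ := contourCoord.surjective c
  obtain ⟨hc₁, hW, hW1, hV, h₄, hx⟩ := contourCoord_mem_admissible hβp hc
  have hint := (integrable_separatedIntegrand
    (ae_expTilt_of_ae (hm.ae_pos hαm hβm hβm1 hlamm) lamm) hκ hx hV h₄ (add_pos hlamp hlamm)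
    (sub_pos.2 hplam) (hm.integrable_rpow_expTilt hαm hβm hβm1 hlamm (by linarith))
    (hp.integrable_coupledFactor_measureMellin_expTilt hαp hβp hβp1 hlamp hc₁ hW hW1)).congr
    (.of_forall (separatedIntegrand_measureMellin_expTilt hp hm hαp hβp hβp1 hlamp hαm hβm hβm1
      hlamm hc₁ (add_pos hV hW)))
  have hconst : ((Real.exp (tsA αp βp * lamp ^ βp + tsA αm βm * lamm ^ βm) / (βp * βm) : ℝ) : ℂ)
      ≠ 0 := ofReal_ne_zero.2 (by positivity)
  exact mbIntegrable_callIntegrand_iff.2 ((integrable_const_mul_iff hconst.isUnit _).1 hint)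

theorem integral_truncExp (h : IsTS μ αp βp lamp αm βm lamm) (hαp : 0 < αp)
    (hβp : 0 < βp) (hβp1 : βp < 1) (hlamp : 0 < lamp) (hαm : 0 < αm) (hβm : 0 < βm)
    (hβm1 : βm < 1) (hlamm : 0 < lamm) (hplam : p < lamp) (hκ : 0 < κ)
    (hc : c ∈ admissible βp βm) :
    ((∫ x, truncExp κ p x ∂μ : ℝ) : ℂ) =
      (Real.exp (tsA αp βp * lamp ^ βp + tsA αm βm * lamm ^ βm) / (βp * βm) : ℝ) * mbIntegral c
        (callIntegrand βp βm (lamp + lamm) (lamp - p) (tsA αp βp) (tsA αm βm) (-κ)) := by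
  obtain ⟨μp, μm, hp, hm, rfl⟩ := h
  have := hp.isProb
  have := hm.isProb
  obtain ⟨⟨⟨c₁, cW⟩, ⟨cV, c₄⟩⟩, rfl⟩ := contourCoord.surjective c
  obtain ⟨hc₁, hW, -, hV, -⟩ := contourCoord_mem_admissible hβp hc
  have hFubini := integral_separatedIntegrand_expTilt hp hm hαp hβp hβp1 hlamp hαm hβm hβm1 hlamm
    hplam hκ hc
  simp only [separatedIntegrand_measureMellin_expTilt hp hm hαp hβp hβp1 hlamp hαm hβm hβm1 hlamm
    hc₁ (add_pos hV hW), integral_const_mul] at hFubini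
  have hpi : ((2 * Real.pi) ^ 4 : ℂ) ≠ 0 := by simp [Real.pi_ne_zero]
  rw [mbIntegral_callIntegrand, ← mul_div_assoc, hFubini, mul_div_cancel_left₀ _ hpi, conv_map_neg,
    integral_map (by fun_prop) measurable_truncExp.aestronglyMeasurable]

end IsTS

end TruncatedMoments

/-! ### Pricing -/

section Pricing

open Set Filter

lemma condExp_natural_bot {Ω ι E F : Type*} [MeasurableSpace Ω] {P : Measure Ω}
    [IsProbabilityMeasure P] [PartialOrder ι] [OrderBot ι] [TopologicalSpace E]
    [TopologicalSpace.MetrizableSpace E] [MeasurableSpace E] [BorelSpace E]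
    [NormedAddCommGroup F] [NormedSpace ℝ F] [CompleteSpace F]
    {X : ι → Ω → E} (hXm : ∀ t, StronglyMeasurable (X t)) {x₀ : E} (hX₀ : ∀ᵐ ω ∂P, X ⊥ ω = x₀)
    (t : ι) {φ : E → F} (hφ : StronglyMeasurable φ) :
    P[fun ω => φ (X t ω) | Filtration.natural X hXm ⊥] =ᵐ[P] fun _ => ∫ ω, φ (X t ω) ∂P := by
  have hindep : IndepFun (X t) (X ⊥) P := by
    refine (indepFun_const_right (X t) x₀).congr .rfl ?_
    filter_upwards [hX₀] with ω hω using hω.symm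
  have hnatural : (Filtration.natural X hXm ⊥ : MeasurableSpace Ω) =
      MeasurableSpace.comap (X ⊥) inferInstance := by
    refine le_antisymm (iSup₂_le fun j hj => ?_) (le_iSup₂_of_le ⊥ le_rfl le_rfl)
    rw [le_bot_iff.1 hj]
  refine condExp_indep_eq (hXm t).measurable.comap_le (Filtration.le _ _)
    (hφ.comp_measurable (comap_measurable (X t))) ?_
  rw [hnatural]
  exact (IndepFun_iff_Indep _ _ _).1 hindep

lemma IsTSProcess.isTS_map {Ω : Type*} [MeasurableSpace Ω] {P : Measure Ω} {X : ℝ≥0 → Ω → ℝ}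
    {αp βp lamp αm βm lamm : ℝ} (hX : IsTSProcess P X αp βp lamp αm βm lamm) {t : ℝ≥0}
    (ht : 0 < t) : IsTS (P.map (X t)) (αp * t) βp lamp (αm * t) βm lamm := by
  have hlaw := hX.law 0 t ht
  simp only [NNReal.coe_zero, sub_zero] at hlaw
  have hmap : P.map (X t) = P.map fun ω => X t ω - X 0 ω := by
    refine Measure.map_congr ?_
    filter_upwards [hX.zero] with ω hω
    rw [hω, sub_zero]
  rwa [hmap]

lemma tsA_mul (α β t : ℝ) : tsA (α * t) β = tsA α β * t := by
  rw [tsA, tsA]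
  ring

lemma tsGamma_mul (αp βp lamp αm βm lamm t : ℝ) :
    tsGamma (αp * t) βp lamp (αm * t) βm lamm = tsGamma αp βp lamp αm βm lamm * t := by
  rw [tsGamma, tsGamma, tsA_mul, tsA_mul]
  ring

/-- The power call payoff `S ^ p 1_{S > K}`, which interpolates between the cash-or-nothing
(`p = 0`) and the asset-or-nothing (`p = 1`) payoffs. -/
noncomputable def payoffPower (p K S : ℝ) : ℝ := (Ioi K).indicator (· ^ p) S

lemma measurable_payoffPower (p K : ℝ) : Measurable (payoffPower p K) :=
  Measurable.indicator (by fun_prop) measurableSet_Ioi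

lemma payoffPower_zero : payoffPower 0 = payoffCN := by
  funext K S
  simp only [payoffPower, payoffCN, Real.rpow_zero]

lemma payoffPower_one : payoffPower 1 = payoffAN := by
  funext K S
  simp only [payoffPower, payoffAN, Real.rpow_one]

lemma mul_exp_eq_mul_exp_moneyness {S₀ K r q ζ T : ℝ} (hS₀ : 0 < S₀) (hK : 0 < K) (x : ℝ) :
    S₀ * Real.exp ((r - q + ζ) * T + x) = K * Real.exp (moneyness S₀ K r q ζ T + x) := by
  rw [moneyness, add_assoc, Real.exp_add (Real.log _), Real.exp_log (div_pos hS₀ hK)]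
  field_simp

lemma payoffPower_mul_exp {K : ℝ} (hK : 0 < K) (p k x : ℝ) :
    payoffPower p K (K * Real.exp (k + x)) = K ^ p * Real.exp (p * k) * truncExp (-k) p x := by
  have hmem : K * Real.exp (k + x) ∈ Ioi K ↔ x ∈ Ioi (-k) := by
    rw [mem_Ioi, lt_mul_iff_one_lt_right hK, Real.one_lt_exp_iff, mem_Ioi, neg_lt_iff_pos_add']
  simp only [payoffPower, truncExp, indicator_apply, hmem, mul_ite, mul_zero]
  rw [Real.mul_rpow hK.le (Real.exp_pos _).le, ← Real.exp_mul, mul_assoc, ← Real.exp_add,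
    mul_comm (k + x), mul_add]

section Market

variable {Ω : Type*} {X : ℝ≥0 → Ω → ℝ}

lemma payoffPower_assetPrice {S₀ K r q ζ : ℝ} {T : ℝ≥0} (hS₀ : 0 < S₀) (hK : 0 < K) (p : ℝ)
    (ω : Ω) :
    payoffPower p K (assetPrice X S₀ r q ζ T ω) =
      K ^ p * Real.exp (p * moneyness S₀ K r q ζ T) *
        truncExp (-moneyness S₀ K r q ζ T) p (X T ω) := by
  rw [assetPrice, mul_exp_eq_mul_exp_moneyness hS₀ hK, payoffPower_mul_exp hK]

variable [MeasurableSpace Ω] {P : Measure Ω}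

lemma claimPrice_zero [IsProbabilityMeasure P] (hXm : ∀ t, StronglyMeasurable (X t))
    (hX₀ : ∀ᵐ ω ∂P, X 0 ω = 0) {payoff : ℝ → ℝ} (hpayoff : Measurable payoff)
    (S₀ r q ζ : ℝ) (T : ℝ≥0) :
    claimPrice P X hXm S₀ r q ζ payoff T 0 =ᵐ[P]
      fun _ => Real.exp (-r * T) * ∫ ω, payoff (assetPrice X S₀ r q ζ T ω) ∂P := by
  have hcond := condExp_natural_bot hXm hX₀ T
    (φ := fun x => Real.exp (-r * T) * payoff (S₀ * Real.exp ((r - q + ζ) * T + x)))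
    (Measurable.stronglyMeasurable (by fun_prop))
  rw [integral_const_mul] at hcond
  simpa only [claimPrice, assetPrice, NNReal.coe_zero, sub_zero, bot_eq_zero'] using hcond

end Market

end Pricing

theorem mainTheorem10_general {Ω : Type*} [MeasurableSpace Ω] (P : Measure Ω)
    [IsProbabilityMeasure P] (αp βp lamp αm βm lamm : ℝ)
    (hαp : 0 < αp) (hβp : 0 < βp) (hβp1 : βp < 1) (hlamp : 0 < lamp)
    (hαm : 0 < αm) (hβm : 0 < βm) (hβm1 : βm < 1) (hlamm : 0 < lamm)
    (X : ℝ≥0 → Ω → ℝ) (hXm : ∀ t, StronglyMeasurable (X t)) (T : ℝ≥0) (hT : 0 < T)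
    (hX₀ : ∀ᵐ ω ∂P, X 0 ω = 0) (hlaw : IsTS (P.map (X T)) (αp * T) βp lamp (αm * T) βm lamm)
    (S₀ K r q ζ : ℝ) (hS₀ : 0 < S₀) (hK : 0 < K) (γ k : ℝ)
    (hγ : γ = tsGamma αp βp lamp αm βm lamm) (hk : k = moneyness S₀ K r q ζ T) (hk0 : k < 0)
    (p : ℝ) (hplam : p < lamp) (c : Fin 4 → ℝ) (hc : c ∈ admissible βp βm) :
    Integrable (fun ω => payoffPower p K (assetPrice X S₀ r q ζ T ω)) P ∧
      MBIntegrable c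
        (callIntegrand βp βm (lamp + lamm) (lamp - p) (tsA αp βp * T) (tsA αm βm * T) k) ∧
      ∀ᵐ ω ∂P, ((claimPrice P X hXm S₀ r q ζ (payoffPower p K) T 0 ω : ℝ) : ℂ) =
        ((K ^ p * Real.exp (p * k + (γ - r) * T) / (βp * βm) : ℝ) : ℂ) *
          mbIntegral c (callIntegrand βp βm (lamp + lamm) (lamp - p)
            (tsA αp βp * T) (tsA αm βm * T) k) := by
  have hαpT : 0 < αp * T := mul_pos hαp hT
  have hαmT : 0 < αm * T := mul_pos hαm hT
  have hκ : 0 < -k := neg_pos.2 hk0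
  have hXT : AEMeasurable (X T) P := (hXm T).measurable.aemeasurable
  have hpayoff (ω : Ω) : payoffPower p K (assetPrice X S₀ r q ζ T ω) =
      K ^ p * Real.exp (p * k) * truncExp (-k) p (X T ω) :=
    hk ▸ payoffPower_assetPrice hS₀ hK p ω
  have hMB := hlaw.mbIntegrable_callIntegrand hαpT hβp hβp1 hlamp hαmT hβm hβm1 hlamm hplam hκ hc
  have hmean := hlaw.integral_truncExp hαpT hβp hβp1 hlamp hαmT hβm hβm1 hlamm hplam hκ hc
  rw [tsA_mul, tsA_mul, neg_neg] at hMB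
  rw [← tsGamma, tsGamma_mul, ← hγ, tsA_mul, tsA_mul, neg_neg,
    integral_map hXT measurable_truncExp.aestronglyMeasurable] at hmean
  refine ⟨?_, hMB, ?_⟩
  · simp only [hpayoff]
    exact ((hlaw.integrable_truncExp hαpT hβp hβp1 hlamp hplam hκ.le).comp_aemeasurable
      hXT).const_mul _
  · filter_upwards [claimPrice_zero hXm hX₀ (measurable_payoffPower p K) S₀ r q ζ T] with ω hω
    have hexp : Real.exp (p * k + (γ - r) * T) =
        Real.exp (-r * T) * Real.exp (p * k) * Real.exp (γ * T) := by
      rw [← Real.exp_add, ← Real.exp_add]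
      ring_nf
    rw [hω]
    simp only [hpayoff, integral_const_mul]
    rw [Complex.ofReal_mul, Complex.ofReal_mul, hmean, hexp]
    push_cast
    ring

theorem mainTheorem10 {Ω : Type*} [MeasurableSpace Ω] (P : Measure Ω) [IsProbabilityMeasure P]
    (αp βp lamp αm βm lamm : ℝ)
    (hαp : 0 < αp) (hβp : 0 < βp) (hβp1 : βp < 1) (hlamp : 1 < lamp)
    (hαm : 0 < αm) (hβm : 0 < βm) (hβm1 : βm < 1) (hlamm : 0 < lamm)
    (X : ℝ≥0 → Ω → ℝ) (hXm : ∀ t, StronglyMeasurable (X t))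
    (hX : IsTSProcess P X αp βp lamp αm βm lamm)
    (S₀ K r q : ℝ) (hS₀ : 0 < S₀) (hK : 0 < K) (T : ℝ≥0) (hT : 0 < T)
    (ζ γ k : ℝ)
    (hζ : ζ = tsZeta αp βp lamp αm βm lamm)
    (hγ : γ = tsGamma αp βp lamp αm βm lamm)
    (hk : k = moneyness S₀ K r q ζ T) (hk0 : k < 0)
    (c : Fin 4 → ℝ) (hc : c ∈ admissible βp βm) :
    (Integrable (fun ω => payoffCN K (assetPrice X S₀ r q ζ T ω)) P ∧
      MBIntegrable c
        (callIntegrand βp βm (lamp + lamm) lamp (tsA αp βp * T) (tsA αm βm * T) k) ∧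
      ∀ᵐ ω ∂P, ((claimPrice P X hXm S₀ r q ζ (payoffCN K) T 0 ω : ℝ) : ℂ) =
        ((Real.exp ((γ - r) * T) / (βp * βm) : ℝ) : ℂ) *
          mbIntegral c
            (callIntegrand βp βm (lamp + lamm) lamp (tsA αp βp * T) (tsA αm βm * T) k)) ∧
    (Integrable (fun ω => payoffAN K (assetPrice X S₀ r q ζ T ω)) P ∧
      MBIntegrable c
        (callIntegrand βp βm (lamp + lamm) (lamp - 1) (tsA αp βp * T) (tsA αm βm * T) k) ∧
      ∀ᵐ ω ∂P, ((claimPrice P X hXm S₀ r q ζ (payoffAN K) T 0 ω : ℝ) : ℂ) =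
        ((K * Real.exp (k + (γ - r) * T) / (βp * βm) : ℝ) : ℂ) *
          mbIntegral c
            (callIntegrand βp βm (lamp + lamm) (lamp - 1)
              (tsA αp βp * T) (tsA αm βm * T) k)) := by
  have hlaw := hX.isTS_map hT
  have hpower := mainTheorem10_general P αp βp lamp αm βm lamm hαp hβp hβp1 (one_pos.trans hlamp)
    hαm hβm hβm1 hlamm X hXm T hT hX.zero hlaw S₀ K r q ζ hS₀ hK γ k hγ hk hk0
  constructor
  · simpa only [payoffPower_zero, sub_zero, Real.rpow_zero, one_mul, zero_mul, zero_add] using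
      hpower 0 (one_pos.trans hlamp) c hc
  · simpa only [payoffPower_one, Real.rpow_one, one_mul] using hpower 1 hlamp c hc
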